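/- Let $G$ be a finitely generated (discrete) group that is virtually abelian, i.e. has an abelian subgroup of finite index. Let $H^2(G;\mathbb{T})=Z^2(G;\mathbb{T})/B^2(G;\mathbb{T})$ be the second cohomology group with coefficients in the circle group $\mathbb{T}$ with trivial action: $2$-cocycles $\sigma\colon G\times G\to\mathbb{T}$, $\sigma(g,h)\sigma(gh,k)=\sigma(g,hk)\sigma(h,k)$, modulo the coboundaries $\gamma(g)\gamma(gh)^{-1}\gamma(h)$. Every class has a normalized representative, i.e. one with $\sigma(e,g)=\sigma(g,e)=1$ for all $g\in G$. For a normalized $2$-cocycle $\sigma$, let $\mathbb{C}[G,\sigma]$ be the $*$-algebra with basis $(\eta_g)_{g\in G}$ and $\eta_g\eta_h=\sigma(g,h)\eta_{gh}$, $\eta_g^*=\sigma(g,g^{-1})^{-1}\eta_{g^{-1}}$, and let the full twisted group $C^*$-algebra $C^*(G,\sigma)$ be its completion in the norm $\|a\|=\sup_\pi\|\pi(a)\|$, where $\pi$ runs over the unital $*$-representations of $\mathbb{C}[G,\sigma]$ on Hilbert spaces. Then for every normalized $2$-cocycle $\sigma$, with class $[\sigma]\in H^2(G;\mathbb{T})$,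 the following are equivalent: (i) $[\sigma]$ is rational: it has a representative $\tau$ such that for all $x,y\in G$ there is a rational number $\theta=\theta(x,y)$ with $\tau(x,y)=e^{2\pi i\theta}$; (ii) there are an integer $n\ge 1$ and a representative of $[\sigma]$ with values in the $n$-th roots of unity; (iii) $[\sigma]$ is type I: there is a subgroup $N\le G$ of finite index such that the restriction of $[\sigma]$ to $H^2(N;\mathbb{T})$ is trivial; (iv) $[\sigma]$ is a torsion element of $H^2(G;\mathbb{T})$; (v) $C^*(G,\sigma)$ is subhomogeneous: there is an $n\in\mathbb{N}$ such that every irreducible $*$-representation of $C^*(G,\sigma)$ on a Hilbert space $\mathcal{H}$ satisfies $\dim\mathcal{H}\le n$; (vi) $C^*(G,\sigma)$ has a (nonzero) finite-dimensional representation: there is a unital $*$-homomorphism $C^*(G,\sigma)\to M_n(\mathbb{C})$ for some $n\ge 1$. -/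

import Mathlib

noncomputable section

universe u v w

/-! ### Virtually abelian groups -/

/-- A group is virtually abelian if it has an abelian subgroup of finite index. -/
def IsVirtuallyAbelian (G : Type u) [Group G] : Prop :=
  ∃ H : Subgroup G, H.FiniteIndex ∧ ∀ x ∈ H, ∀ y ∈ H, x * y = y * x

/-! ### The second cohomology group with trivial coefficients

The coefficient group `A` is written multiplicatively. -/

/-- The group `Z²(G; A)` of 2-cocycles, under pointwise multiplication. -/
def twoCocycles (G : Type u) [Group G] (A : Type v) [CommGroup A] : Subgroup (G → G → A) where
  carrier := {σ | ∀ g h k, σ g h * σ (g * h) k = σ g (h * k) * σ h k}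
  one_mem' := by intro g h k; simp
  mul_mem' := by
    intro σ τ hσ hτ g h k
    have h1 := hσ g h k
    have h2 := hτ g h k
    simp only [Pi.mul_apply]
    rw [mul_mul_mul_comm, h1, h2, mul_mul_mul_comm]
  inv_mem' := by
    intro σ hσ g h k
    have h1 := hσ g h k
    simp only [Pi.inv_apply]
    rw [← mul_inv, ← mul_inv, h1]

/-- The group `B²(G; A)` of 2-coboundaries. -/
def twoCoboundaries (G : Type u) [Group G] (A : Type v) [CommGroup A] :
    Subgroup (G → G → A) where
  carrier := {σ | ∃ γ : G → A, ∀ g h, σ g h = γ g * (γ (g * h))⁻¹ * γ h}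
  one_mem' := ⟨1, by intro g h; simp⟩
  mul_mem' := by
    rintro σ τ ⟨γ, hγ⟩ ⟨δ, hδ⟩
    refine ⟨γ * δ, fun g h => ?_⟩
    simp only [Pi.mul_apply, hγ, hδ, mul_inv]
    rw [mul_mul_mul_comm, mul_mul_mul_comm (γ g)]
  inv_mem' := by
    rintro σ ⟨γ, hγ⟩
    refine ⟨γ⁻¹, fun g h => ?_⟩
    simp only [Pi.inv_apply, hγ, mul_inv]

/-- Every 2-coboundary is a 2-cocycle. -/
theorem twoCoboundaries_le (G : Type u) [Group G] (A : Type v) [CommGroup A] :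
    twoCoboundaries G A ≤ twoCocycles G A := by
  rintro σ ⟨γ, hγ⟩ g h k
  simp only [hγ, mul_assoc g h k]
  have e1 : (γ (g * h))⁻¹ * γ (g * h) = 1 := inv_mul_cancel _
  have e2 : (γ (h * k))⁻¹ * γ (h * k) = 1 := inv_mul_cancel _
  calc γ g * (γ (g * h))⁻¹ * γ h * (γ (g * h) * (γ (g * (h * k)))⁻¹ * γ k)
      = ((γ (g * h))⁻¹ * γ (g * h)) * (γ g * γ h * (γ (g * (h * k)))⁻¹ * γ k) := by
        simp only [mul_comm, mul_left_comm, mul_assoc]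
    _ = ((γ (h * k))⁻¹ * γ (h * k)) * (γ g * γ h * (γ (g * (h * k)))⁻¹ * γ k) := by
        rw [e1, e2]
    _ = _ := by simp only [mul_comm, mul_left_comm, mul_assoc]

/-- `H²(G; A) = Z²(G; A) / B²(G; A)`. -/
abbrev H2 (G : Type u) [Group G] (A : Type v) [CommGroup A] : Type (max u v) :=
  twoCocycles G A ⧸ (twoCoboundaries G A).subgroupOf (twoCocycles G A)

/-- The cohomology class `[σ]` of a 2-cocycle. -/
def H2.mk {G : Type u} [Group G] {A : Type v} [CommGroup A] (σ : twoCocycles G A) : H2 G A :=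
  QuotientGroup.mk σ

/-- The pullback of 2-cocycles along a group homomorphism. -/
def twoCocyclesPullback {G : Type u} [Group G] {K : Type w} [Group K] (A : Type v) [CommGroup A]
    (φ : K →* G) : twoCocycles G A →* twoCocycles K A where
  toFun σ := ⟨fun x y => σ.1 (φ x) (φ y), fun x y z => by
    simpa only [map_mul] using σ.2 (φ x) (φ y) (φ z)⟩
  map_one' := rfl
  map_mul' _ _ := rfl

/-- The map `φ^* : H²(G; A) → H²(K; A)` induced by a group homomorphism `φ : K → G`. -/
def H2.pullback {G : Type u} [Group G] {K : Type w} [Group K] (A : Type v) [CommGroup A]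
    (φ : K →* G) : H2 G A →* H2 K A :=
  QuotientGroup.map _ _ (twoCocyclesPullback A φ) (by
    rintro σ ⟨γ, hγ⟩
    refine ⟨fun x => γ (φ x), fun x y => ?_⟩
    change σ.1 (φ x) (φ y) = γ (φ x) * (γ (φ (x * y)))⁻¹ * γ (φ y)
    rw [map_mul]
    exact hγ (φ x) (φ y))

/-- The normalized 2-cocycles: `σ(e, g) = σ(g, e)` is the neutral element for all `g`. -/
abbrev NormalizedTwoCocycle (G : Type u) [Group G] (A : Type v) [CommGroup A] : Type (max u v) :=
  {σ : twoCocycles G A // ∀ g, σ.1 1 g = 1 ∧ σ.1 g 1 = 1}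

/-- The cohomology class of a normalized 2-cocycle. -/
def NormalizedTwoCocycle.cls {G : Type u} [Group G] {A : Type v} [CommGroup A]
    (σ : NormalizedTwoCocycle G A) : H2 G A :=
  H2.mk σ.1

/-- Every cohomology class is represented by a normalized cocycle. -/
theorem NormalizedTwoCocycle.cls_surjective {G : Type u} [Group G] {A : Type v} [CommGroup A] :
    Function.Surjective (NormalizedTwoCocycle.cls : NormalizedTwoCocycle G A → H2 G A) := by
  intro c
  obtain ⟨σ, rfl⟩ := QuotientGroup.mk_surjective c
  have hc : (fun _ _ => (σ.1 1 1)⁻¹ : G → G → A) ∈ twoCoboundaries G A :=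
    ⟨fun _ => (σ.1 1 1)⁻¹, fun g h => by simp⟩
  let b : twoCocycles G A := ⟨_, twoCoboundaries_le G A hc⟩
  refine ⟨⟨σ * b, fun g => ⟨?_, ?_⟩⟩, ?_⟩
  · have := σ.2 1 1 g
    simp only [one_mul, mul_left_inj] at this
    change σ.1 1 g * (σ.1 1 1)⁻¹ = 1
    rw [← this, mul_inv_cancel]
  · have := σ.2 g 1 1
    simp only [mul_one, mul_right_inj] at this
    change σ.1 g 1 * (σ.1 1 1)⁻¹ = 1
    rw [this, mul_inv_cancel]
  · refine (QuotientGroup.eq.2 ?_).symm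
    rw [inv_mul_cancel_left]
    exact hc

/-! ### Rational, root-of-unity valued and type I classes -/

/-- A class in `H²(G; 𝕋)` is rational if it has a representative all of whose values are of the
form `e^{2πiθ}` with `θ` rational (depending on the arguments). -/
def H2.IsRational {G : Type u} [Group G] (c : H2 G Circle) : Prop :=
  ∃ τ : twoCocycles G Circle, H2.mk τ = c ∧
    ∀ x y : G, ∃ θ : ℚ, (τ.1 x y : ℂ) = Complex.exp (2 * Real.pi * Complex.I * (θ : ℂ))

/-- For some `n ≥ 1`, the class has a representative with values in the `n`-th roots of unity. -/
def H2.HasRootOfUnityRepresentative {G : Type u} [Group G] (c : H2 G Circle) : Prop :=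
  ∃ n : ℕ, 0 < n ∧ ∃ τ : twoCocycles G Circle, H2.mk τ = c ∧ ∀ x y : G, τ.1 x y ^ n = 1

/-- A class is type I if its restriction to some subgroup of finite index is trivial. -/
def H2.IsTypeI {G : Type u} [Group G] (c : H2 G Circle) : Prop :=
  ∃ N : Subgroup G, N.FiniteIndex ∧ H2.pullback Circle N.subtype c = 1

/-! ### The twisted group algebra -/

/-- The twisted group algebra `ℂ[G, σ]`: finite linear combinations of the elements of `G`. -/
def TwistedGroupAlgebra {G : Type u} [Group G] (_σ : NormalizedTwoCocycle G Circle) : Type u :=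
  G →₀ ℂ

namespace TwistedGroupAlgebra

variable {G : Type u} [Group G] {σ : NormalizedTwoCocycle G Circle}

instance : AddCommGroup (TwistedGroupAlgebra σ) := inferInstanceAs (AddCommGroup (G →₀ ℂ))

instance : Module ℂ (TwistedGroupAlgebra σ) := inferInstanceAs (Module ℂ (G →₀ ℂ))

/-- The multiple `x • η_g` of the basis element `η_g`. -/
def single (σ : NormalizedTwoCocycle G Circle) (g : G) (x : ℂ) : TwistedGroupAlgebra σ :=
  Finsupp.single g x

/-- `(∑ x_g η_g) (∑ y_h η_h) = ∑ x_g y_h σ(g, h) η_{gh}`. -/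
instance : Mul (TwistedGroupAlgebra σ) :=
  ⟨fun a b => Finsupp.sum (α := G) (M := ℂ) a fun g x =>
    Finsupp.sum (α := G) (M := ℂ) b fun h y => single σ (g * h) (x * y * (σ.1.1 g h : ℂ))⟩

/-- The unit is `η_e`. -/
instance : One (TwistedGroupAlgebra σ) := ⟨single σ 1 1⟩

/-- `(∑ x_g η_g)^* = ∑ conj(x_g) σ(g, g⁻¹)⁻¹ η_{g⁻¹}`. -/
instance : Star (TwistedGroupAlgebra σ) :=
  ⟨fun a => Finsupp.sum (α := G) (M := ℂ) a fun g x =>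
    single σ g⁻¹ (star x * (σ.1.1 g g⁻¹ : ℂ)⁻¹)⟩

theorem single_zero (g : G) : single σ g 0 = 0 := Finsupp.single_zero g

theorem single_add (g : G) (x y : ℂ) : single σ g (x + y) = single σ g x + single σ g y :=
  Finsupp.single_add g x y

theorem smul_single (c : ℂ) (g : G) (x : ℂ) : c • single σ g x = single σ g (c * x) :=
  Finsupp.smul_single c g x

theorem induction {p : TwistedGroupAlgebra σ → Prop} (a : TwistedGroupAlgebra σ)
    (h0 : p 0) (hadd : ∀ a b, p a → p b → p (a + b)) (hs : ∀ g x, p (single σ g x)) : p a :=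
  Finsupp.induction_linear (motive := p) a h0 hadd hs

theorem single_mul_single (g h : G) (x y : ℂ) :
    single σ g x * single σ h y = single σ (g * h) (x * y * (σ.1.1 g h : ℂ)) := by
  refine (Finsupp.sum_single_index ?_).trans (Finsupp.sum_single_index ?_)
  · refine (Finsupp.sum_single_index ?_).trans ?_ <;> simp [single_zero]
  · simp [single_zero]

theorem star_single (g : G) (x : ℂ) :
    star (single σ g x) = single σ g⁻¹ (star x * (σ.1.1 g g⁻¹ : ℂ)⁻¹) :=
  Finsupp.sum_single_index (by simp [single_zero])

theorem one_def : (1 : TwistedGroupAlgebra σ) = single σ 1 1 := rfl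

protected theorem zero_mul (a : TwistedGroupAlgebra σ) : 0 * a = 0 := Finsupp.sum_zero_index

protected theorem mul_zero (a : TwistedGroupAlgebra σ) : a * 0 = 0 :=
  (Finset.sum_congr rfl fun _ _ => Finsupp.sum_zero_index).trans Finset.sum_const_zero

protected theorem add_mul (a b c : TwistedGroupAlgebra σ) : (a + b) * c = a * c + b * c := by
  classical
  refine Finsupp.sum_add_index' (fun g => ?_) (fun g x y => ?_)
  · exact (Finset.sum_congr rfl fun h _ => by simp [single_zero]).trans Finset.sum_const_zero
  · refine Eq.trans (Finset.sum_congr rfl fun h _ => ?_) Finset.sum_add_distrib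
    change single σ _ ((x + y) * _ * _) = single σ _ (x * _ * _) + single σ _ (y * _ * _)
    rw [add_mul, add_mul, single_add]

protected theorem mul_add (a b c : TwistedGroupAlgebra σ) : a * (b + c) = a * b + a * c := by
  classical
  refine Eq.trans (Finset.sum_congr rfl fun g _ => ?_) Finset.sum_add_distrib
  refine Finsupp.sum_add_index' (fun h => by simp [single_zero]) (fun h x y => ?_)
  rw [mul_add, add_mul, single_add]

/-- The cocycle identity, in `ℂ`. -/
theorem cocycle (g h k : G) :
    (σ.1.1 g h : ℂ) * (σ.1.1 (g * h) k : ℂ) = (σ.1.1 g (h * k) : ℂ) * (σ.1.1 h k : ℂ) := by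
  exact_mod_cast congrArg (fun z : Circle => (z : ℂ)) (σ.1.2 g h k)

theorem cocycle_one_left (g : G) : (σ.1.1 1 g : ℂ) = 1 := by rw [(σ.2 g).1]; rfl

theorem cocycle_one_right (g : G) : (σ.1.1 g 1 : ℂ) = 1 := by rw [(σ.2 g).2]; rfl

theorem cocycle_inv (g : G) : (σ.1.1 g⁻¹ g : ℂ) = (σ.1.1 g g⁻¹ : ℂ) := by
  have := cocycle (σ := σ) g g⁻¹ g
  simpa [cocycle_one_left, cocycle_one_right] using this.symm

protected theorem mul_assoc (a b c : TwistedGroupAlgebra σ) : a * b * c = a * (b * c) := by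
  induction a using TwistedGroupAlgebra.induction with
  | h0 => simp only [TwistedGroupAlgebra.zero_mul]
  | hadd a a' h h' => simp only [TwistedGroupAlgebra.add_mul, h, h']
  | hs g x =>
    induction b using TwistedGroupAlgebra.induction with
    | h0 => simp only [TwistedGroupAlgebra.zero_mul, TwistedGroupAlgebra.mul_zero]
    | hadd b b' h h' => simp only [TwistedGroupAlgebra.add_mul, TwistedGroupAlgebra.mul_add, h, h']
    | hs h y =>
      induction c using TwistedGroupAlgebra.induction with
      | h0 => simp only [TwistedGroupAlgebra.mul_zero]
      | hadd c c' h h' => simp only [TwistedGroupAlgebra.mul_add, h, h']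
      | hs k z =>
        rw [single_mul_single, single_mul_single, single_mul_single, single_mul_single, mul_assoc]
        congr 1
        linear_combination x * y * z * cocycle (σ := σ) g h k

protected theorem one_mul (a : TwistedGroupAlgebra σ) : 1 * a = a := by
  induction a using TwistedGroupAlgebra.induction with
  | h0 => exact TwistedGroupAlgebra.mul_zero _
  | hadd a a' h h' => rw [TwistedGroupAlgebra.mul_add, h, h']
  | hs g x => rw [one_def, single_mul_single, cocycle_one_left, one_mul, one_mul, mul_one]

protected theorem mul_one (a : TwistedGroupAlgebra σ) : a * 1 = a := by
  induction a using TwistedGroupAlgebra.induction with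
  | h0 => exact TwistedGroupAlgebra.zero_mul _
  | hadd a a' h h' => rw [TwistedGroupAlgebra.add_mul, h, h']
  | hs g x => rw [one_def, single_mul_single, cocycle_one_right, mul_one, mul_one, mul_one]

instance : Ring (TwistedGroupAlgebra σ) where
  __ := (inferInstance : AddCommGroup (TwistedGroupAlgebra σ))
  left_distrib := TwistedGroupAlgebra.mul_add
  right_distrib := TwistedGroupAlgebra.add_mul
  zero_mul := TwistedGroupAlgebra.zero_mul
  mul_zero := TwistedGroupAlgebra.mul_zero
  mul_assoc := TwistedGroupAlgebra.mul_assoc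
  one_mul := TwistedGroupAlgebra.one_mul
  mul_one := TwistedGroupAlgebra.mul_one

instance : Algebra ℂ (TwistedGroupAlgebra σ) :=
  Algebra.ofModule
    (by
      intro r a b
      induction a using TwistedGroupAlgebra.induction with
      | h0 => simp
      | hadd a a' h h' => rw [smul_add, add_mul, add_mul, smul_add, h, h']
      | hs g x =>
        induction b using TwistedGroupAlgebra.induction with
        | h0 => simp
        | hadd b b' h h' => rw [mul_add, mul_add, smul_add, h, h']
        | hs h y =>
          rw [smul_single, single_mul_single, single_mul_single, smul_single]
          congr 1; ring)
    (by
      intro r a b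
      induction a using TwistedGroupAlgebra.induction with
      | h0 => simp
      | hadd a a' h h' => rw [add_mul, add_mul, smul_add, h, h']
      | hs g x =>
        induction b using TwistedGroupAlgebra.induction with
        | h0 => simp
        | hadd b b' h h' => rw [smul_add, mul_add, mul_add, smul_add, h, h']
        | hs h y =>
          rw [smul_single, single_mul_single, single_mul_single, smul_single]
          congr 1; ring)

theorem star_zero' : star (0 : TwistedGroupAlgebra σ) = 0 := Finsupp.sum_zero_index

theorem star_add' (a b : TwistedGroupAlgebra σ) : star (a + b) = star a + star b := by
  classical
  refine Finsupp.sum_add_index' (fun g => by simp [single_zero]) (fun g x y => ?_)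
  rw [star_add, add_mul, single_add]

theorem star_coe_circle (z : Circle) : star (z : ℂ) = (z : ℂ)⁻¹ := by
  rw [← Circle.coe_inv, Circle.coe_inv_eq_conj]; rfl

instance : StarRing (TwistedGroupAlgebra σ) where
  star_involutive a := by
    induction a using TwistedGroupAlgebra.induction with
    | h0 => rw [star_zero', star_zero']
    | hadd a a' h h' => rw [star_add', star_add', h, h']
    | hs g x =>
      rw [star_single, star_single, inv_inv, star_mul', star_star, star_inv₀, star_coe_circle,
        inv_inv, cocycle_inv, mul_assoc, mul_inv_cancel₀ (Circle.coe_ne_zero _), mul_one]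
  star_mul a b := by
    induction a using TwistedGroupAlgebra.induction with
    | h0 => simp only [zero_mul, mul_zero, star_zero']
    | hadd a a' h h' => simp only [add_mul, mul_add, star_add', h, h']
    | hs g x =>
      induction b using TwistedGroupAlgebra.induction with
      | h0 => simp only [zero_mul, mul_zero, star_zero']
      | hadd b b' h h' => simp only [add_mul, mul_add, star_add', h, h']
      | hs h y =>
        rw [star_single, star_single, single_mul_single, single_mul_single, star_single,
          mul_inv_rev, star_mul', star_mul', star_coe_circle]
        congr 1
        have e1 := cocycle (σ := σ) g h (h⁻¹ * g⁻¹)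
        have e2 := cocycle (σ := σ) h h⁻¹ g⁻¹
        rw [mul_inv_cancel_left] at e1
        rw [mul_inv_cancel, cocycle_one_left, mul_one] at e2
        have n1 := Circle.coe_ne_zero (σ.1.1 g h)
        have n2 := Circle.coe_ne_zero (σ.1.1 (g * h) (h⁻¹ * g⁻¹))
        have n3 := Circle.coe_ne_zero (σ.1.1 h h⁻¹)
        have n4 := Circle.coe_ne_zero (σ.1.1 g g⁻¹)
        field_simp
        linear_combination star x * star y * (σ.1.1 g g⁻¹ : ℂ) * e2
          - star x * star y * (σ.1.1 h⁻¹ g⁻¹ : ℂ) * e1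
  star_add := star_add'

instance : StarModule ℂ (TwistedGroupAlgebra σ) where
  star_smul r a := by
    induction a using TwistedGroupAlgebra.induction with
    | h0 => simp
    | hadd a a' h h' => rw [smul_add, star_add, h, h', star_add, smul_add]
    | hs g x => rw [smul_single, star_single, star_single, smul_single, star_mul', mul_assoc]

/-! ### The full C*-seminorm -/

/-- The set of all `‖π(a)‖`, where `π` runs over the (unital) *-representations of `ℂ[G, σ]` by
bounded operators on Hilbert spaces. (Each basis element is unitary in `ℂ[G, σ]`, hence is sent to
a unitary operator; as every vector lies in a cyclic summand of cardinality
controlled by `G`, Hilbert spaces in the universe of `G` suffice.) -/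
def repNorms (a : TwistedGroupAlgebra σ) : Set ℝ :=
  {r | ∃ (H : Type u) (_ : NormedAddCommGroup H) (_ : InnerProductSpace ℂ H)
    (_ : CompleteSpace H) (π : TwistedGroupAlgebra σ →⋆ₐ[ℂ] (H →L[ℂ] H)), r = ‖π a‖}

/-- The norm of `ℂ[G, σ]` whose completion is the full twisted group C*-algebra. -/
instance : Norm (TwistedGroupAlgebra σ) := ⟨fun a => sSup (repNorms a)⟩

theorem norm_def (a : TwistedGroupAlgebra σ) : ‖a‖ = sSup (repNorms a) := rfl

theorem star_single_mul_single (g : G) (x : ℂ) :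
    star (single σ g x) * single σ g x = (star x * x) • (1 : TwistedGroupAlgebra σ) := by
  rw [star_single, single_mul_single, one_def, smul_single, inv_mul_cancel, cocycle_inv]
  congr 1
  have := Circle.coe_ne_zero (σ.1.1 g g⁻¹)
  field_simp

theorem bddAbove_repNorms (a : TwistedGroupAlgebra σ) : BddAbove (repNorms a) := by
  induction a using TwistedGroupAlgebra.induction with
  | h0 =>
    refine ⟨0, ?_⟩
    rintro r ⟨H, _, _, _, π, rfl⟩
    simp
  | hadd a b ha hb =>
    obtain ⟨A, hA⟩ := ha
    obtain ⟨B, hB⟩ := hb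
    refine ⟨A + B, ?_⟩
    rintro r ⟨H, i1, i2, i3, π, rfl⟩
    rw [map_add]
    exact (norm_add_le _ _).trans
      (add_le_add (hA ⟨H, i1, i2, i3, π, rfl⟩) (hB ⟨H, i1, i2, i3, π, rfl⟩))
  | hs g x =>
    refine ⟨‖x‖, ?_⟩
    rintro r ⟨H, _, _, _, π, rfl⟩
    have h1 : ‖π (single σ g x)‖ * ‖π (single σ g x)‖ ≤ ‖x‖ * ‖x‖ := by
      rw [← CStarRing.norm_star_mul_self, ← map_star, ← map_mul, star_single_mul_single, map_smul,
        map_one, norm_smul, norm_mul, norm_star]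
      exact mul_le_of_le_one_right (by positivity) ContinuousLinearMap.norm_id_le
    exact (mul_self_le_mul_self_iff (norm_nonneg _) (norm_nonneg _)).2 h1

theorem repNorms_nonempty (a : TwistedGroupAlgebra σ) : (repNorms a).Nonempty :=
  ⟨_, EuclideanSpace ℂ PEmpty.{u + 1}, inferInstance, inferInstance, inferInstance,
    { toFun := fun _ => 0
      map_one' := Subsingleton.elim _ _
      map_mul' := fun _ _ => Subsingleton.elim _ _
      map_zero' := rfl
      map_add' := fun _ _ => Subsingleton.elim _ _
      commutes' := fun _ => Subsingleton.elim _ _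
      map_star' := fun _ => Subsingleton.elim _ _ }, rfl⟩

theorem norm_rep_le {H : Type u} [NormedAddCommGroup H] [InnerProductSpace ℂ H] [CompleteSpace H]
    (π : TwistedGroupAlgebra σ →⋆ₐ[ℂ] (H →L[ℂ] H)) (a : TwistedGroupAlgebra σ) : ‖π a‖ ≤ ‖a‖ :=
  le_csSup (bddAbove_repNorms a) ⟨H, _, _, _, π, rfl⟩

theorem norm_le_of_forall (a : TwistedGroupAlgebra σ) (C : ℝ)
    (h : ∀ (H : Type u) [NormedAddCommGroup H] [InnerProductSpace ℂ H] [CompleteSpace H]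
      (π : TwistedGroupAlgebra σ →⋆ₐ[ℂ] (H →L[ℂ] H)), ‖π a‖ ≤ C) : ‖a‖ ≤ C := by
  refine csSup_le (repNorms_nonempty a) ?_
  rintro r ⟨H, _, _, _, π, rfl⟩
  exact h H π

theorem norm_nonneg' (a : TwistedGroupAlgebra σ) : 0 ≤ ‖a‖ := by
  obtain ⟨r, hr⟩ := repNorms_nonempty a
  refine le_trans ?_ (le_csSup (bddAbove_repNorms a) hr)
  obtain ⟨H, _, _, _, π, rfl⟩ := hr
  exact norm_nonneg _

/-- The full C*-seminorm as a ring seminorm. -/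
def ringSeminorm (σ : NormalizedTwoCocycle G Circle) : RingSeminorm (TwistedGroupAlgebra σ) where
  toFun a := ‖a‖
  map_zero' := le_antisymm (norm_le_of_forall _ _ fun H _ _ _ π => by simp) (norm_nonneg' _)
  add_le' a b := norm_le_of_forall _ _ fun H _ _ _ π => by
    rw [map_add]
    exact (norm_add_le _ _).trans (add_le_add (norm_rep_le π a) (norm_rep_le π b))
  neg' a := by
    refine le_antisymm (norm_le_of_forall _ _ fun H _ _ _ π => ?_)
      (norm_le_of_forall _ _ fun H _ _ _ π => ?_)
    · rw [map_neg, norm_neg]; exact norm_rep_le π a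
    · rw [← norm_neg, ← map_neg]; exact norm_rep_le π (-a)
  mul_le' a b := norm_le_of_forall _ _ fun H _ _ _ π => by
    rw [map_mul]
    exact (norm_mul_le _ _).trans
      (mul_le_mul (norm_rep_le π a) (norm_rep_le π b) (norm_nonneg _) (norm_nonneg' _))

instance : SeminormedRing (TwistedGroupAlgebra σ) where
  __ := (inferInstance : Ring (TwistedGroupAlgebra σ))
  __ := (ringSeminorm σ).toAddGroupSeminorm.toSeminormedAddCommGroup
  toNorm := inferInstance
  norm_mul_le := (ringSeminorm σ).mul_le'

instance : NormedAlgebra ℂ (TwistedGroupAlgebra σ) where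
  norm_smul_le c a := norm_le_of_forall _ _ fun H _ _ _ π => by
    rw [map_smul, norm_smul]
    exact mul_le_mul_of_nonneg_left (norm_rep_le π a) (norm_nonneg _)

instance : NormedStarGroup (TwistedGroupAlgebra σ) where
  norm_star_le a := norm_le_of_forall _ _ fun H _ _ _ π => by
    rw [map_star, norm_star]
    exact norm_rep_le π a

/-- The C*-inequality for the full seminorm. -/
theorem norm_mul_self_le (a : TwistedGroupAlgebra σ) : ‖a‖ * ‖a‖ ≤ ‖star a * a‖ := by
  have h : ‖a‖ ≤ Real.sqrt ‖star a * a‖ := norm_le_of_forall _ _ fun H _ _ _ π => by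
    refine Real.le_sqrt_of_sq_le ?_
    rw [sq, ← CStarRing.norm_star_mul_self, ← map_star, ← map_mul]
    exact norm_rep_le π _
  calc ‖a‖ * ‖a‖ ≤ Real.sqrt ‖star a * a‖ * Real.sqrt ‖star a * a‖ :=
        mul_self_le_mul_self (norm_nonneg _) h
    _ = ‖star a * a‖ := Real.mul_self_sqrt (norm_nonneg _)

end TwistedGroupAlgebra

/-! ### The full twisted group C*-algebra -/

/-- `C*(G, σ)`: the completion of `ℂ[G, σ]` with respect to the full C*-norm. -/
def TwistedGroupCStarAlgebra {G : Type u} [Group G] (σ : NormalizedTwoCocycle G Circle) : Type u :=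
  UniformSpace.Completion (TwistedGroupAlgebra σ)

namespace TwistedGroupCStarAlgebra

open UniformSpace

variable {G : Type u} [Group G] {σ : NormalizedTwoCocycle G Circle}

instance : NormedRing (TwistedGroupCStarAlgebra σ) :=
  inferInstanceAs (NormedRing (Completion (TwistedGroupAlgebra σ)))

instance : CompleteSpace (TwistedGroupCStarAlgebra σ) :=
  inferInstanceAs (CompleteSpace (Completion (TwistedGroupAlgebra σ)))

instance : Algebra ℂ (TwistedGroupCStarAlgebra σ) :=
  inferInstanceAs (Algebra ℂ (Completion (TwistedGroupAlgebra σ)))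

instance : NormedAlgebra ℂ (TwistedGroupCStarAlgebra σ) where
  norm_smul_le c a := norm_smul_le (β := Completion (TwistedGroupAlgebra σ)) c a

/-- The canonical map `ℂ[G, σ] → C*(G, σ)`. -/
def of (a : TwistedGroupAlgebra σ) : TwistedGroupCStarAlgebra σ :=
  ((a : Completion (TwistedGroupAlgebra σ)))

theorem continuous_of : Continuous (of : TwistedGroupAlgebra σ → TwistedGroupCStarAlgebra σ) :=
  Completion.continuous_coe _

theorem of_add (a b : TwistedGroupAlgebra σ) : of (a + b) = of a + of b := Completion.coe_add a b

theorem of_mul (a b : TwistedGroupAlgebra σ) : of (a * b) = of a * of b := Completion.coe_mul a b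

theorem of_smul (c : ℂ) (a : TwistedGroupAlgebra σ) : of (c • a) = c • of a :=
  Completion.coe_smul c a

theorem norm_of (a : TwistedGroupAlgebra σ) : ‖of a‖ = ‖a‖ := Completion.norm_coe a

theorem induction {p : TwistedGroupCStarAlgebra σ → Prop} (a : TwistedGroupCStarAlgebra σ)
    (hp : IsClosed {a | p a}) (ih : ∀ a, p (of a)) : p a :=
  Completion.induction_on (p := p) a hp ih

/-- The involution, extended by continuity from `ℂ[G, σ]`. -/
instance : Star (TwistedGroupCStarAlgebra σ) :=
  ⟨Completion.map (star : TwistedGroupAlgebra σ → TwistedGroupAlgebra σ)⟩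

theorem star_of (a : TwistedGroupAlgebra σ) : star (of a) = of (star a) :=
  Completion.map_coe (starNormedAddGroupHom
    (E := TwistedGroupAlgebra σ)).uniformContinuous a

theorem continuous_star' :
    Continuous (star : TwistedGroupCStarAlgebra σ → TwistedGroupCStarAlgebra σ) :=
  Completion.continuous_map

instance : StarRing (TwistedGroupCStarAlgebra σ) where
  star_involutive a := by
    induction a using TwistedGroupCStarAlgebra.induction with
    | hp => exact isClosed_eq (continuous_star'.comp continuous_star') continuous_id
    | ih a => rw [star_of, star_of, star_star]
  star_mul a b := by
    induction a using TwistedGroupCStarAlgebra.induction with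
    | hp =>
      exact isClosed_eq (continuous_star'.comp (continuous_id.mul continuous_const))
        (continuous_const.mul continuous_star')
    | ih a =>
      induction b using TwistedGroupCStarAlgebra.induction with
      | hp =>
        exact isClosed_eq (continuous_star'.comp (continuous_const.mul continuous_id))
          (continuous_star'.mul continuous_const)
      | ih b => rw [← of_mul, star_of, star_of, star_of, star_mul, of_mul]
  star_add a b := by
    induction a using TwistedGroupCStarAlgebra.induction with
    | hp =>
      exact isClosed_eq (continuous_star'.comp (continuous_id.add continuous_const))
        (continuous_star'.add continuous_const)
    | ih a =>
      induction b using TwistedGroupCStarAlgebra.induction with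
      | hp =>
        exact isClosed_eq (continuous_star'.comp (continuous_const.add continuous_id))
          (continuous_const.add continuous_star')
      | ih b => rw [← of_add, star_of, star_of, star_of, star_add, of_add]

/-- `C*(G, σ)` is a unital C*-algebra. -/
instance : CStarAlgebra (TwistedGroupCStarAlgebra σ) where
  norm_mul_self_le a := by
    induction a using TwistedGroupCStarAlgebra.induction with
    | hp =>
      exact isClosed_le (continuous_norm.mul continuous_norm)
        (continuous_norm.comp (continuous_star'.mul continuous_id))
    | ih a =>
      rw [star_of, ← of_mul, norm_of, norm_of]
      exact TwistedGroupAlgebra.norm_mul_self_le a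
  star_smul c a := by
    induction a using TwistedGroupCStarAlgebra.induction with
    | hp =>
      exact isClosed_eq (continuous_star'.comp (continuous_const_smul c))
        (continuous_star'.const_smul (star c))
    | ih a => rw [← of_smul, star_of, star_of, star_smul, of_smul]

end TwistedGroupCStarAlgebra

/-! ### Representations of unital C*-algebras -/

/-- A (unital) *-representation on a Hilbert space `H` is irreducible if `H ≠ 0` and the only closed
invariant subspaces are `0` and `H`. -/
def IsIrreducibleRep {A : Type u} [CStarAlgebra A] {H : Type v} [NormedAddCommGroup H]
    [InnerProductSpace ℂ H] [CompleteSpace H] (π : A →⋆ₐ[ℂ] (H →L[ℂ] H)) : Prop :=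
  Nontrivial H ∧ ∀ K : Submodule ℂ H, IsClosed (K : Set H) →
    (∀ a : A, ∀ x ∈ K, π a x ∈ K) → K = ⊥ ∨ K = ⊤

/-- A unital C*-algebra is subhomogeneous if the dimensions of its irreducible representations have
a uniform finite bound. (An irreducible representation is cyclic, so that, up to unitary
equivalence, its Hilbert space lies in the universe of `A`.) -/
def IsSubhomogeneous (A : Type u) [CStarAlgebra A] : Prop :=
  ∃ n : ℕ, ∀ (H : Type u) [NormedAddCommGroup H] [InnerProductSpace ℂ H] [CompleteSpace H]
    (π : A →⋆ₐ[ℂ] (H →L[ℂ] H)), IsIrreducibleRep π → Module.rank ℂ H ≤ (n : Cardinal.{u})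

/-- A unital C*-algebra has a (nonzero) finite-dimensional representation: a unital *-homomorphism
to `M_n(ℂ)` for some `n ≥ 1`. -/
def HasFiniteDimensionalRep (A : Type u) [CStarAlgebra A] : Prop :=
  ∃ n : ℕ, 0 < n ∧ Nonempty (A →⋆ₐ[ℂ] Matrix (Fin n) (Fin n) ℂ)

end

noncomputable section

universe u v w

/-! The conditions are linked in one cycle: rational, type I, subhomogeneous, finite-dimensional
representation, torsion, root-of-unity representative, rational. The hypotheses on `G` enter in the
first two implications.

Rational to type I (`H2.IsTypeI.of_isRational`): on an abelian subgroup `H` of finite index, the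
commutator pairing τ(x,y)τ(y,x)⁻¹ is bimultiplicative with torsion values. As `H` is finitely
generated, its radical contains a subgroup of finite index, on which τ is symmetric. A symmetric
cocycle defines an abelian extension by the circle, which splits because the circle is divisible.

Type I to subhomogeneous (`rank_le_of_isIrreducibleRep`): on a suitable normal abelian subgroup `M`
of finite index the canonical unitaries commute. In an irreducible representation Schur's lemma
makes each of them algebraic: it is a root of the polynomial whose roots are its finitely many
conjugates, and the coefficients are invariant, hence scalar. A joint eigenvector for `M` then
exists, and its translates along `G ⧸ M` span an invariant subspace of dimension at most the index,
hence everything.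

Subhomogeneous to finite-dimensional: the regular representation supplies a state, Krein–Milman an
extreme state, and the GNS construction an irreducible representation (`exists_isIrreducibleRep`),
whose dimension is finite by assumption. Finite-dimensional to torsion: determinants of the
canonical unitaries in dimension n exhibit σⁿ as a coboundary. Torsion to roots of unity: correct σ
by n-th roots of a cochain trivializing σⁿ. -/

/-! ### Equality of cohomology classes and divisibility of the circle -/

theorem H2.mk_eq_mk_iff {G : Type u} [Group G] {A : Type v} [CommGroup A] (σ τ : twoCocycles G A) :
    H2.mk σ = H2.mk τ ↔ ∃ γ : G → A, ∀ g h, τ.1 g h = σ.1 g h * (γ g * (γ (g * h))⁻¹ * γ h) := by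
  refine QuotientGroup.eq.trans ?_
  constructor
  · rintro ⟨γ, hγ⟩
    refine ⟨γ, fun g h => ?_⟩
    rw [← hγ g h]
    exact (mul_inv_cancel_left _ _).symm
  · rintro ⟨γ, hγ⟩
    refine ⟨γ, fun g h => ?_⟩
    change (σ.1 g h)⁻¹ * τ.1 g h = _
    rw [hγ g h, inv_mul_cancel_left]

theorem H2.mk_eq_one_iff {G : Type u} [Group G] {A : Type v} [CommGroup A] (σ : twoCocycles G A) :
    H2.mk σ = 1 ↔ ∃ γ : G → A, ∀ g h, σ.1 g h = γ g * (γ (g * h))⁻¹ * γ h := by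
  exact QuotientGroup.eq_one_iff σ

theorem Circle.exists_pow_eq (n : ℕ) (hn : n ≠ 0) (z : Circle) : ∃ w : Circle, w ^ n = z := by
  refine ⟨Circle.exp (Complex.arg z / n), ?_⟩
  rw [← Circle.exp_natCast_mul]
  have : (n : ℝ) ≠ 0 := by exact_mod_cast hn
  rw [mul_div_cancel₀ _ this, Circle.exp_arg]

/-- Divisible abelian groups are injective ℤ-modules. This is what splits abelian extensions by the
circle. -/
theorem Circle.baer : Module.Baer ℤ (Additive Circle) := by
  have : ∀ n : ℤ, n ≠ 0 → Function.Surjective (fun a : Additive Circle => n • a) := by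
    intro n hn z
    obtain ⟨w, hw⟩ := Circle.exists_pow_eq n.natAbs (by simpa using hn) z.toMul
    rcases Int.natAbs_eq n with h | h
    · refine ⟨Additive.ofMul w, ?_⟩
      apply Additive.toMul.injective
      simp only [toMul_zsmul, toMul_ofMul]
      rw [h, zpow_natCast, hw]
    · refine ⟨Additive.ofMul w⁻¹, ?_⟩
      apply Additive.toMul.injective
      simp only [toMul_zsmul, toMul_ofMul]
      rw [h, inv_zpow', neg_neg, zpow_natCast, hw]
  let _ : DivisibleBy (Additive Circle) ℤ := divisibleByOfSMulRightSurj _ _ fun {n} hn => this n hn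
  exact Module.Baer.of_divisible _

/-! ### Central extensions, symmetric cocycles and the commutator pairing -/

namespace twoCocycles

variable {G : Type u} [Group G] {A : Type v} [CommGroup A]

theorem apply_one_left (σ : twoCocycles G A) (g : G) : σ.1 1 g = σ.1 1 1 := by
  have := σ.2 1 1 g
  simp only [one_mul, mul_left_inj] at this
  exact this.symm

theorem apply_one_right (σ : twoCocycles G A) (g : G) : σ.1 g 1 = σ.1 1 1 := by
  have := σ.2 g 1 1
  simp only [mul_one, mul_right_inj] at this
  exact this

/-- The central extension of `G` by `A` defined by a 2-cocycle. -/
@[ext] structure Extension (σ : twoCocycles G A) where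
  fst : A
  snd : G

namespace Extension

variable (σ : twoCocycles G A)

instance : Mul (Extension σ) := ⟨fun x y => ⟨x.fst * y.fst * σ.1 x.snd y.snd, x.snd * y.snd⟩⟩

instance : One (Extension σ) := ⟨⟨(σ.1 1 1)⁻¹, 1⟩⟩

instance : Inv (Extension σ) :=
  ⟨fun x => ⟨x.fst⁻¹ * (σ.1 x.snd⁻¹ x.snd)⁻¹ * (σ.1 1 1)⁻¹, x.snd⁻¹⟩⟩

theorem mul_def (x y : Extension σ) :
    x * y = ⟨x.fst * y.fst * σ.1 x.snd y.snd, x.snd * y.snd⟩ := rfl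

theorem one_def : (1 : Extension σ) = ⟨(σ.1 1 1)⁻¹, 1⟩ := rfl

theorem inv_def (x : Extension σ) :
    x⁻¹ = ⟨x.fst⁻¹ * (σ.1 x.snd⁻¹ x.snd)⁻¹ * (σ.1 1 1)⁻¹, x.snd⁻¹⟩ := rfl

instance : Group (Extension σ) where
  mul_assoc x y z := by
    ext
    · simp only [mul_def]
      have := σ.2 x.snd y.snd z.snd
      calc _ = x.fst * y.fst * z.fst * (σ.1 x.snd y.snd * σ.1 (x.snd * y.snd) z.snd) := by
            simp only [mul_comm, mul_left_comm, mul_assoc]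
        _ = _ := by rw [this]; simp only [mul_comm, mul_left_comm, mul_assoc]
    · simp only [mul_def, mul_assoc]
  one_mul x := by
    ext
    · simp [mul_def, one_def, apply_one_left σ x.snd]
    · simp [mul_def, one_def]
  mul_one x := by
    ext
    · simp [mul_def, one_def, apply_one_right σ x.snd]
    · simp [mul_def, one_def]
  inv_mul_cancel x := by
    ext
    · simp only [mul_def, inv_def, one_def]
      calc _ = (x.fst⁻¹ * x.fst) * ((σ.1 x.snd⁻¹ x.snd)⁻¹ * σ.1 x.snd⁻¹ x.snd) * (σ.1 1 1)⁻¹ := by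
            simp only [mul_comm, mul_left_comm, mul_assoc]
        _ = _ := by rw [inv_mul_cancel, inv_mul_cancel, one_mul, one_mul]
    · simp [mul_def, one_def, inv_def]

/-- The inclusion of the kernel in a central extension. -/
def incl : A →* Extension σ where
  toFun a := ⟨a * (σ.1 1 1)⁻¹, 1⟩
  map_one' := by simp [one_def]
  map_mul' a b := by
    ext
    · simp only [mul_def]
      rw [mul_assoc _ (b * _), inv_mul_cancel_right, mul_right_comm]
    · simp [mul_def]

theorem incl_injective : Function.Injective (incl σ) := fun a b h => by
  simpa [incl] using congrArg Extension.fst h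

end Extension

/-- A symmetric circle-valued 2-cocycle on an abelian group is a coboundary. -/
theorem exists_eq_coboundary_of_symm (σ : twoCocycles G Circle)
    (hG : ∀ x y : G, x * y = y * x) (hσ : ∀ x y, σ.1 x y = σ.1 y x) :
    ∃ γ : G → Circle, ∀ g h, σ.1 g h = γ g * (γ (g * h))⁻¹ * γ h := by
  let _ : CommGroup (Extension σ) :=
    { (inferInstance : Group (Extension σ)) with
      mul_comm := fun x y => by
        simp only [Extension.mul_def, hσ x.snd y.snd, mul_comm x.fst, hG x.snd] }
  -- Injectivity extends the identity of the circle along `incl`, giving a retraction ρ of the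
  -- extension onto its kernel. Restricting ρ to the set-theoretic section x ↦ (1, x) gives the
  -- cochain.
  obtain ⟨r, hr⟩ := Circle.baer.extension_property_addMonoidHom
    (MonoidHom.toAdditive (Extension.incl σ))
    (fun a b h => Extension.incl_injective σ h) (AddMonoidHom.id (Additive Circle))
  let ρ : Extension σ →* Circle := AddMonoidHom.toMultiplicative r
  have hρ : ∀ a, ρ (Extension.incl σ a) = a := fun a => DFunLike.congr_fun hr (Additive.ofMul a)
  refine ⟨fun x => ρ ⟨1, x⟩, fun g h => ?_⟩
  have key : (⟨1, g⟩ * ⟨1, h⟩ : Extension σ) = Extension.incl σ (σ.1 g h) * ⟨1, g * h⟩ := by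
    ext
    · simp [Extension.mul_def, Extension.incl, apply_one_left σ (g * h)]
    · simp [Extension.mul_def, Extension.incl]
  have := congrArg ρ key
  rw [map_mul, map_mul, hρ] at this
  rw [mul_right_comm, this, mul_inv_cancel_right]

/-- The commutator pairing of a 2-cocycle is multiplicative in the first argument on commuting
elements. -/
theorem commutator_mul_left (σ : twoCocycles G A) {x y z : G} (hxz : x * z = z * x)
    (hyz : y * z = z * y) :
    σ.1 (x * y) z * (σ.1 z (x * y))⁻¹ =
      (σ.1 x z * (σ.1 z x)⁻¹) * (σ.1 y z * (σ.1 z y)⁻¹) := by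
  have h1 := σ.2 x y z
  have h2 := σ.2 z x y
  have h3 := σ.2 x z y
  rw [hyz] at h1
  rw [← hxz] at h2
  rw [← div_eq_mul_inv, ← div_eq_mul_inv, ← div_eq_mul_inv, div_mul_div_comm, div_eq_div_iff_mul_eq_mul]
  -- This factor completes both sides to products of cocycle identities for the triples (x,y,z),
  -- (z,x,y) and (x,z,y).
  apply mul_left_cancel (a := σ.1 x y * σ.1 (x * z) y)
  calc _ = (σ.1 x y * σ.1 (x * y) z) * (σ.1 z x * σ.1 (x * z) y) * σ.1 z y := by
        simp only [mul_comm, mul_left_comm, mul_assoc]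
    _ = (σ.1 x (z * y) * σ.1 z y) * σ.1 y z * (σ.1 z (x * y) * σ.1 x y) := by
      rw [h1, h2]; simp only [mul_comm, mul_left_comm, mul_assoc]
    _ = (σ.1 x z * σ.1 (x * z) y) * σ.1 y z * (σ.1 z (x * y) * σ.1 x y) := by rw [h3]
    _ = _ := by simp only [mul_comm, mul_left_comm, mul_assoc]

end twoCocycles

/-! ### Implications between the cohomological conditions -/

theorem H2.IsRational.of_hasRootOfUnityRepresentative {G : Type u} [Group G] {c : H2 G Circle}
    (h : c.HasRootOfUnityRepresentative) : c.IsRational := by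
  obtain ⟨n, hn, τ, hτ, hr⟩ := h
  refine ⟨τ, hτ, fun x y => ?_⟩
  have : (τ.1 x y : ℂ) ^ n = 1 := by exact_mod_cast congrArg (fun z : Circle => (z : ℂ)) (hr x y)
  have hz : (τ.1 x y : ℂ) ≠ 0 := Circle.coe_ne_zero _
  have hn' : (n : ℂ) ≠ 0 := by exact_mod_cast hn.ne'
  rw [← Complex.exp_log hz, ← Complex.exp_nat_mul, Complex.exp_eq_one_iff] at this
  obtain ⟨k, hk⟩ := this
  refine ⟨k / n, ?_⟩
  rw [← Complex.exp_log hz]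
  congr 1
  push_cast
  field_simp
  linear_combination hk

/-- If σⁿ is the coboundary of γ, choose pointwise n-th roots of γ. Dividing σ by the coboundary of
these roots leaves a cohomologous cocycle whose n-th power is 1. -/
theorem H2.HasRootOfUnityRepresentative.of_isOfFinOrder {G : Type u} [Group G] {c : H2 G Circle}
    (h : IsOfFinOrder c) : c.HasRootOfUnityRepresentative := by
  obtain ⟨n, hn, hc⟩ := isOfFinOrder_iff_pow_eq_one.1 h
  obtain ⟨σ, rfl⟩ := QuotientGroup.mk_surjective c
  obtain ⟨γ, hγ⟩ := (H2.mk_eq_one_iff (σ ^ n)).1 hc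
  choose r hr using Circle.exists_pow_eq n hn.ne'
  let b : twoCocycles G Circle := ⟨fun g h => (r (γ g))⁻¹ * (r (γ (g * h)))⁻¹⁻¹ * (r (γ h))⁻¹,
    twoCoboundaries_le _ _ ⟨fun g => (r (γ g))⁻¹, fun g h => rfl⟩⟩
  refine ⟨n, hn, σ * b, ((H2.mk_eq_mk_iff _ _).2 ⟨fun g => (r (γ g))⁻¹, fun g h => rfl⟩).symm,
    fun x y => ?_⟩
  have : σ.1 x y ^ n = γ x * (γ (x * y))⁻¹ * γ y := hγ x y
  change (σ.1 x y * ((r (γ x))⁻¹ * (r (γ (x * y)))⁻¹⁻¹ * (r (γ y))⁻¹)) ^ n = 1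
  rw [mul_pow, mul_pow, mul_pow, inv_pow, inv_pow, inv_pow, inv_pow, hr, hr, hr, this]
  rw [← mul_inv, ← mul_inv, mul_inv_cancel]

theorem Subgroup.finiteIndex_map_subtype {G : Type u} [Group G] (H : Subgroup G) [H.FiniteIndex]
    (K : Subgroup H) [K.FiniteIndex] : (K.map H.subtype).FiniteIndex := by
  refine ⟨?_⟩
  rw [Subgroup.index_map_subtype]
  exact mul_ne_zero FiniteIndex.index_ne_zero FiniteIndex.index_ne_zero

/-- The orders of the values of τ need not be bounded a priori. Finite generation of `H` repairs
this: each homomorphism `pairing y` has finitely generated torsion, hence finite, image, so its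
kernel has finite index. -/
theorem H2.IsTypeI.of_isRational {G : Type u} [Group G] (hfg : Group.FG G)
    (hva : IsVirtuallyAbelian G) {c : H2 G Circle} (h : c.IsRational) : c.IsTypeI := by
  obtain ⟨τ, rfl, hτ⟩ := h
  obtain ⟨H, hH, hcomm⟩ := hva
  have htor : ∀ x y, IsOfFinOrder (τ.1 x y) := by
    intro x y
    obtain ⟨θ, hθ⟩ := hτ x y
    refine isOfFinOrder_iff_pow_eq_one.2 ⟨θ.den, θ.den_pos, ?_⟩
    apply Circle.ext
    rw [Circle.coe_pow, hθ, ← Complex.exp_nat_mul, Circle.coe_one, Complex.exp_eq_one_iff]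
    refine ⟨θ.num, ?_⟩
    have : (θ.den : ℂ) * (θ : ℂ) = θ.num := by exact_mod_cast Rat.den_mul_eq_num θ
    linear_combination 2 * Real.pi * Complex.I * this
  let pairing (y : H) : H →* Circle :=
    { toFun := fun x => τ.1 x y * (τ.1 y x)⁻¹
      map_one' := by
        simp [twoCocycles.apply_one_left τ y.1, twoCocycles.apply_one_right τ y.1]
      map_mul' := fun a b =>
        twoCocycles.commutator_mul_left τ (hcomm _ a.2 _ y.2) (hcomm _ b.2 _ y.2) }
  have hfgH : Group.FG H := inferInstance
  have hker : ∀ y, (pairing y).ker.FiniteIndex := by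
    intro y
    have : Group.FG (pairing y).range := inferInstance
    have : Finite (pairing y).range := by
      refine CommGroup.finite_of_fg_isMulTorsion _ ?_
      rintro ⟨_, x, rfl⟩
      refine (Submonoid.isOfFinOrder_coe (H := (pairing y).range.toSubmonoid)).1 ?_
      exact (htor _ _).mul (htor _ _).inv
    exact Subgroup.finiteIndex_ker _
  obtain ⟨S, hS⟩ := Group.fg_def.1 hfgH
  -- A finite generating set suffices: the pairing is also multiplicative in the other variable, so
  -- an element pairing trivially with `S` pairs trivially with all of `H`.
  let R : Subgroup H := ⨅ s : S, (pairing s).ker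
  have hR : R.FiniteIndex := Subgroup.finiteIndex_iInf fun s => hker s
  have hsymm : ∀ x ∈ R, ∀ y : H, τ.1 x y = τ.1 y x := by
    intro x hx y
    have h1 : ∀ s ∈ S, pairing x s = 1 := by
      intro s hs
      have : pairing s x = 1 := (Subgroup.mem_iInf.1 hx ⟨s, hs⟩ :)
      rw [← inv_eq_one, ← this]
      change (τ.1 s x * (τ.1 x s)⁻¹)⁻¹ = τ.1 x s * (τ.1 s x)⁻¹
      rw [mul_inv, inv_inv, mul_comm]
    have h2 : (⊤ : Subgroup H) ≤ (pairing x).ker := by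
      rw [← hS, Subgroup.closure_le]
      exact h1
    have h3 : pairing x y = 1 := h2 (Subgroup.mem_top y)
    exact (mul_inv_eq_one.1 h3).symm
  refine ⟨R.map H.subtype, H.finiteIndex_map_subtype R, ?_⟩
  refine (H2.mk_eq_one_iff _).2 (twoCocycles.exists_eq_coboundary_of_symm _ ?_ ?_)
  · rintro ⟨_, x, hx, rfl⟩ ⟨_, y, hy, rfl⟩
    exact Subtype.ext (hcomm _ x.2 _ y.2)
  · rintro ⟨_, x, hx, rfl⟩ ⟨_, y, hy, rfl⟩
    exact hsymm x hx y

open scoped ComplexOrder InnerProductSpace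

/-! ### The left regular representation -/

namespace TwistedGroupAlgebra

variable {G : Type u} [Group G] {σ : NormalizedTwoCocycle G Circle}

/-- The unital `*`-representation of `ℂ[G, σ]` defined by a family of isometries `U g` with
`U g * U h = σ(g, h) • U (g * h)`. -/
def lift {H : Type v} [NormedAddCommGroup H] [InnerProductSpace ℂ H] [CompleteSpace H]
    (U : G → (H →L[ℂ] H)) (hone : U 1 = 1)
    (hmul : ∀ g h, U g * U h = (σ.1.1 g h : ℂ) • U (g * h)) (hisom : ∀ g, star (U g) * U g = 1) :
    TwistedGroupAlgebra σ →⋆ₐ[ℂ] (H →L[ℂ] H) :=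
  let L : TwistedGroupAlgebra σ →ₗ[ℂ] (H →L[ℂ] H) :=
    Finsupp.lsum ℂ (M := ℂ) (R := ℂ) fun g => LinearMap.toSpanSingleton ℂ (H →L[ℂ] H) (U g)
  have hL : ∀ g x, L (single σ g x) = x • U g := fun g x => by
    refine (Finsupp.lsum_single _ _ _ _).trans ?_
    rfl
  -- The isometry `U g` has a multiple of `U g⁻¹` as right inverse, which must therefore be its
  -- adjoint.
  have hstar : ∀ g, star (U g) = (σ.1.1 g g⁻¹ : ℂ)⁻¹ • U g⁻¹ := fun g => by
    have h1 := hmul g g⁻¹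
    rw [mul_inv_cancel, hone] at h1
    calc star (U g) = star (U g) * ((σ.1.1 g g⁻¹ : ℂ)⁻¹ • (U g * U g⁻¹)) := by
          rw [h1, smul_smul, inv_mul_cancel₀ (Circle.coe_ne_zero _), one_smul, mul_one]
      _ = _ := by rw [mul_smul_comm, ← mul_assoc, hisom, one_mul]
  { toFun := L
    map_one' := by rw [one_def, hL, hone, one_smul]
    map_mul' := fun a b => by
      induction a using TwistedGroupAlgebra.induction with
      | h0 => rw [zero_mul, map_zero, zero_mul]
      | hadd a a' h h' => rw [add_mul, map_add, map_add, add_mul, h, h']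
      | hs g x =>
        induction b using TwistedGroupAlgebra.induction with
        | h0 => rw [mul_zero, map_zero, mul_zero]
        | hadd b b' h h' => rw [mul_add, map_add, map_add, mul_add, h, h']
        | hs h y =>
          rw [single_mul_single, hL, hL, hL, smul_mul_smul_comm, hmul, smul_smul]
    map_zero' := map_zero _
    map_add' := map_add _
    commutes' := fun r => by
      rw [Algebra.algebraMap_eq_smul_one, map_smul, one_def, hL, hone, one_smul,
        Algebra.algebraMap_eq_smul_one]
    map_star' := fun a => by
      induction a using TwistedGroupAlgebra.induction with
      | h0 => rw [star_zero, map_zero, star_zero]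
      | hadd a a' h h' => rw [star_add, map_add, map_add, star_add, h, h']
      | hs g x => rw [star_single, hL, hL, star_smul, hstar, smul_smul] }

variable (σ) in
/-- The operator `η_g` of the left regular representation, on functions. -/
def regularFun (g : G) (f : G → ℂ) (x : G) : ℂ := (σ.1.1 g (g⁻¹ * x) : ℂ) * f (g⁻¹ * x)

theorem norm_regularFun (g : G) (f : G → ℂ) (x : G) : ‖regularFun σ g f x‖ = ‖f (g⁻¹ * x)‖ := by
  rw [regularFun, norm_mul, Circle.norm_coe, one_mul]

theorem memℓp_regularFun (g : G) (f : lp (fun _ : G => ℂ) 2) :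
    Memℓp (E := fun _ : G => ℂ) (regularFun σ g f) 2 := by
  have h2 : 0 < (2 : ENNReal).toReal := by norm_num
  rw [memℓp_gen_iff h2]
  simp only [norm_regularFun]
  exact (Equiv.summable_iff (Equiv.mulLeft g⁻¹)
    (f := fun i => ‖f i‖ ^ (2 : ENNReal).toReal)).2 ((memℓp_gen_iff h2).1 f.2)

variable (σ) in
/-- The unitary operator `η_g` of the left regular representation. -/
def regularIsometry (g : G) : lp (fun _ : G => ℂ) 2 →ₗᵢ[ℂ] lp (fun _ : G => ℂ) 2 where
  toFun f := ⟨regularFun σ g f, memℓp_regularFun g f⟩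
  map_add' f f' := by
    ext x
    exact mul_add _ _ _
  map_smul' c f := by
    ext x
    exact mul_left_comm _ _ _
  norm_map' f := by
    have h2 : 0 < (2 : ENNReal).toReal := by norm_num
    change ‖(⟨regularFun σ g f, memℓp_regularFun g f⟩ : lp (fun _ : G => ℂ) 2)‖ = ‖f‖
    rw [lp.norm_eq_tsum_rpow h2, lp.norm_eq_tsum_rpow h2]
    simp only [norm_regularFun]
    rw [← Equiv.tsum_eq (Equiv.mulLeft g⁻¹) (f := fun i => ‖f i‖ ^ (2 : ENNReal).toReal)]
    rfl

variable (σ) in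
/-- The left regular representation of `ℂ[G, σ]` on `ℓ²(G)`. -/
def regularRep :
    TwistedGroupAlgebra σ →⋆ₐ[ℂ] (lp (fun _ : G => ℂ) 2 →L[ℂ] lp (fun _ : G => ℂ) 2) :=
  lift (fun g => (regularIsometry σ g).toContinuousLinearMap)
    (by
      ext f x
      change (σ.1.1 1 (1⁻¹ * x) : ℂ) * f (1⁻¹ * x) = f x
      rw [cocycle_one_left, one_mul, inv_one, one_mul])
    (fun g h => by
      ext f x
      change (σ.1.1 g (g⁻¹ * x) : ℂ) * ((σ.1.1 h (h⁻¹ * (g⁻¹ * x)) : ℂ) * f (h⁻¹ * (g⁻¹ * x))) =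
        (σ.1.1 g h : ℂ) * ((σ.1.1 (g * h) ((g * h)⁻¹ * x) : ℂ) * f ((g * h)⁻¹ * x))
      rw [mul_inv_rev, mul_assoc h⁻¹]
      have := cocycle (σ := σ) g h (h⁻¹ * (g⁻¹ * x))
      rw [mul_inv_cancel_left] at this
      linear_combination - f (h⁻¹ * (g⁻¹ * x)) * this)
    (fun g => (ContinuousLinearMap.norm_map_iff_adjoint_comp_self _).1
      (regularIsometry σ g).norm_map)

end TwistedGroupAlgebra

/-! ### Existence of irreducible representations -/

theorem inner_self_eq_ofReal_norm_sq {H : Type v} [NormedAddCommGroup H] [InnerProductSpace ℂ H]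
    (x : H) : ⟪x, x⟫_ℂ = ((‖x‖ ^ 2 : ℝ) : ℂ) := by
  rw [inner_self_eq_norm_sq_to_K, Complex.ofReal_pow]
  rfl

/-- The states of a unital C*-algebra. -/
def stateSpace (A : Type u) [CStarAlgebra A] : Set (WeakDual ℂ A) :=
  WeakDual.toStrongDual ⁻¹' Metric.closedBall 0 1 ∩ {φ | φ 1 = 1 ∧ ∀ a, 0 ≤ φ (star a * a)}

/-- The norm bound built into `stateSpace` makes Banach–Alaoglu applicable; the remaining conditions
are weak-* closed. -/
theorem isCompact_stateSpace (A : Type u) [CStarAlgebra A] : IsCompact (stateSpace A) := by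
  refine (WeakDual.isCompact_closedBall (𝕜 := ℂ) (E := A) 0 1).inter_right ?_
  rw [Set.ofPred_and, Set.ofPred_forall]
  refine (isClosed_eq (WeakDual.eval_continuous _) continuous_const).inter
    (isClosed_iInter fun a => ?_)
  exact isClosed_le continuous_const (WeakDual.eval_continuous _)

section VectorState

variable {A : Type u} [CStarAlgebra A] {H : Type v} [NormedAddCommGroup H]
  [InnerProductSpace ℂ H] [CompleteSpace H]

theorem norm_inner_map_le (π : A →⋆ₐ[ℂ] (H →L[ℂ] H)) (x : H) (a : A) :
    ‖⟪x, π a x⟫_ℂ‖ ≤ ‖x‖ * ‖x‖ * ‖a‖ :=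
  calc ‖⟪x, π a x⟫_ℂ‖ ≤ ‖x‖ * ‖π a x‖ := norm_inner_le_norm _ _
    _ ≤ ‖x‖ * (‖a‖ * ‖x‖) := by
      gcongr
      exact ((π a).le_opNorm x).trans
        (mul_le_mul_of_nonneg_right (NonUnitalStarAlgHom.norm_apply_le π a) (norm_nonneg _))
    _ = _ := by ring

/-- The functional `a ↦ ⟪x, π(a)x⟫`. -/
def vectorFunctional (π : A →⋆ₐ[ℂ] (H →L[ℂ] H)) (x : H) : A →L[ℂ] ℂ :=
  LinearMap.mkContinuous
    { toFun := fun a => ⟪x, π a x⟫_ℂ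
      map_add' := fun a b => by rw [map_add, add_apply, inner_add_right]
      map_smul' := fun c a => by
        rw [map_smul, smul_apply, inner_smul_right]; rfl }
    (‖x‖ * ‖x‖) (norm_inner_map_le π x)

theorem vectorFunctional_apply (π : A →⋆ₐ[ℂ] (H →L[ℂ] H)) (x : H) (a : A) :
    vectorFunctional π x a = ⟪x, π a x⟫_ℂ := rfl

theorem inner_map_star (π : A →⋆ₐ[ℂ] (H →L[ℂ] H)) (a : A) (x y : H) :
    ⟪π (star a) x, y⟫_ℂ = ⟪x, π a y⟫_ℂ := by
  rw [map_star, ContinuousLinearMap.star_eq_adjoint, ContinuousLinearMap.adjoint_inner_left]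

theorem inner_map_star_right (π : A →⋆ₐ[ℂ] (H →L[ℂ] H)) (a : A) (x y : H) :
    ⟪x, π (star a) y⟫_ℂ = ⟪π a x, y⟫_ℂ := by
  rw [← inner_map_star, star_star]

theorem vectorFunctional_mem_stateSpace (π : A →⋆ₐ[ℂ] (H →L[ℂ] H)) {x : H} (hx : ‖x‖ = 1) :
    (StrongDual.toWeakDual (vectorFunctional π x)) ∈ stateSpace A := by
  refine ⟨?_, ?_, fun a => ?_⟩
  · refine mem_closedBall_zero_iff.2 ?_
    refine (LinearMap.mkContinuous_norm_le _ (mul_self_nonneg ‖x‖) (norm_inner_map_le π x)).trans ?_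
    rw [hx, mul_one]
  · change ⟪x, π 1 x⟫_ℂ = 1
    rw [map_one, one_apply_eq_self, inner_self_eq_ofReal_norm_sq, hx]
    simp
  · change 0 ≤ ⟪x, π (star a * a) x⟫_ℂ
    rw [map_mul, mul_apply_eq_comp, inner_map_star_right, inner_self_eq_ofReal_norm_sq]
    exact_mod_cast sq_nonneg ‖π a x‖

/-- A cyclic representation whose vector functional is an extreme point of the state space is
irreducible. -/
theorem isIrreducibleRep_of_extreme (π : A →⋆ₐ[ℂ] (H →L[ℂ] H)) {ξ : H}
    (hcyc : Dense (Set.range fun a => π a ξ)) (hξ : ‖ξ‖ = 1)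
    (hext : StrongDual.toWeakDual (vectorFunctional π ξ) ∈ (stateSpace A).extremePoints ℝ) :
    IsIrreducibleRep π := by
  refine ⟨⟨ξ, 0, fun h => by simp [h] at hξ⟩, fun K hK hinv => ?_⟩
  have : CompleteSpace K := hK.completeSpace_coe
  -- If both components of ξ are nonzero, the vector state of ξ is a proper convex combination of
  -- those of the normalized x and y, with weights ‖x‖² and ‖y‖².
  obtain ⟨x, hx, y, hy, hxy⟩ := K.exists_add_mem_mem_orthogonal ξ
  have hinv' : ∀ a, ∀ z ∈ Kᗮ, π a z ∈ Kᗮ := fun a z hz =>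
    (Submodule.mem_orthogonal _ _).2 fun w hw => by
      rw [← inner_map_star]
      exact (Submodule.mem_orthogonal _ _).1 hz _ (hinv _ _ hw)
  have hdense : ∀ L : Submodule ℂ H, IsClosed (L : Set H) → (∀ a, ∀ z ∈ L, π a z ∈ L) → ξ ∈ L →
      L = ⊤ := fun L hL hLinv hLξ => by
    refine SetLike.coe_injective (Set.univ_subset_iff.1 ?_)
    rw [← hcyc.closure_eq]
    exact closure_minimal (Set.range_subset_iff.2 fun a => hLinv a _ hLξ) hL
  by_cases hx0 : x = 0
  · left
    have := hdense Kᗮ K.isClosed_orthogonal hinv' (by rwa [hxy, hx0, zero_add])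
    rwa [Submodule.orthogonal_eq_top_iff] at this
  by_cases hy0 : y = 0
  · right
    exact hdense K hK hinv (by rwa [hxy, hy0, add_zero])
  exfalso
  have hxy0 : ∀ a, ⟪x, π a y⟫_ℂ = 0 := fun a => (Submodule.mem_orthogonal _ _).1 (hinv' a _ hy) _ hx
  have hyx0 : ∀ a, ⟪y, π a x⟫_ℂ = 0 := fun a =>
    (Submodule.mem_orthogonal' _ _).1 hy _ (hinv a _ hx)
  have hnx : ‖x‖ ≠ 0 := norm_ne_zero_iff.2 hx0
  have hny : ‖y‖ ≠ 0 := norm_ne_zero_iff.2 hy0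
  have hsum : ‖x‖ * ‖x‖ + ‖y‖ * ‖y‖ = 1 := by
    rw [← norm_add_sq_eq_norm_sq_add_norm_sq_of_inner_eq_zero x y
      ((Submodule.mem_orthogonal _ _).1 hy _ hx), ← hxy, hξ, mul_one]
  have hscale : ∀ z : H, ‖z‖ ≠ 0 → ∀ a, ((‖z‖ * ‖z‖ : ℝ) : ℂ) *
      vectorFunctional π (((‖z‖⁻¹ : ℝ) : ℂ) • z) a = ⟪z, π a z⟫_ℂ := fun z hz a => by
    rw [vectorFunctional_apply, map_smul, inner_smul_left, inner_smul_right, Complex.conj_ofReal]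
    have : (‖z‖ : ℂ) ≠ 0 := by exact_mod_cast hz
    push_cast
    field_simp
  have hunit : ∀ z : H, ‖z‖ ≠ 0 → ‖((‖z‖⁻¹ : ℝ) : ℂ) • z‖ = 1 := fun z hz => by
    rw [norm_smul, Complex.norm_real, norm_inv, norm_norm, inv_mul_cancel₀ hz]
  have key := hext.2 (vectorFunctional_mem_stateSpace π (hunit x hnx))
    (vectorFunctional_mem_stateSpace π (hunit y hny))
    ⟨‖x‖ * ‖x‖, ‖y‖ * ‖y‖, by positivity, by positivity, hsum, by
      refine DFunLike.ext _ _ fun a => ?_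
      change ((‖x‖ * ‖x‖ : ℝ) : ℂ) * vectorFunctional π (((‖x‖⁻¹ : ℝ) : ℂ) • x) a +
        ((‖y‖ * ‖y‖ : ℝ) : ℂ) * vectorFunctional π (((‖y‖⁻¹ : ℝ) : ℂ) • y) a = ⟪ξ, π a ξ⟫_ℂ
      rw [hscale x hnx, hscale y hny, hxy, map_add, inner_add_left, inner_add_right,
        inner_add_right, hxy0, hyx0, add_zero, zero_add]⟩
  -- By extremality the state of x/‖x‖ equals that of ξ. Cyclicity then forces x = ‖x‖²ξ, and
  -- pairing with y gives 0 = ‖x‖²‖y‖², a contradiction.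
  have key' : ∀ a, ⟪x, π a ξ⟫_ℂ = ((‖x‖ * ‖x‖ : ℝ) : ℂ) * ⟪ξ, π a ξ⟫_ℂ := fun a => by
    have h1 : vectorFunctional π (((‖x‖⁻¹ : ℝ) : ℂ) • x) a = ⟪ξ, π a ξ⟫_ℂ :=
      DFunLike.congr_fun key a
    rw [← h1, hscale x hnx, hxy, map_add, inner_add_right, hxy0, add_zero]
  have hx' : x - ((‖x‖ * ‖x‖ : ℝ) : ℂ) • ξ = 0 := by
    refine hcyc.eq_zero_of_inner_left (𝕜 := ℂ) ?_
    rintro _ ⟨a, rfl⟩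
    rw [inner_sub_left, inner_smul_left, Complex.conj_ofReal, key', sub_self]
  have h2 : ⟪y, x⟫_ℂ = ((‖x‖ * ‖x‖ : ℝ) : ℂ) * ⟪y, y⟫_ℂ := by
    have h0 : ⟪y, x⟫_ℂ = 0 := (Submodule.mem_orthogonal' _ _).1 hy _ hx
    have : ⟪y, x⟫_ℂ = ((‖x‖ * ‖x‖ : ℝ) : ℂ) * ⟪y, ξ⟫_ℂ := by
      rw [← inner_smul_right, ← sub_eq_zero.1 hx']
    rw [this, hxy, inner_add_right, h0, zero_add]
  rw [(Submodule.mem_orthogonal' _ _).1 hy _ hx, inner_self_eq_ofReal_norm_sq] at h2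
  have : (‖x‖ * ‖x‖) * ‖y‖ ^ 2 = 0 := by exact_mod_cast h2.symm
  simp [hnx, hny] at this

end VectorState

/-- A unital C*-algebra with a state has an irreducible representation. -/
theorem exists_isIrreducibleRep {A : Type u} [CStarAlgebra A] (h : (stateSpace A).Nonempty) :
    ∃ (H : Type u) (_ : NormedAddCommGroup H) (_ : InnerProductSpace ℂ H) (_ : CompleteSpace H)
      (π : A →⋆ₐ[ℂ] (H →L[ℂ] H)), IsIrreducibleRep π := by
  have : LocallyConvexSpace ℝ (WeakDual ℂ A) :=
    WeakBilin.locallyConvexSpace (B := topDualPairing ℂ A)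
  obtain ⟨φ, hφ⟩ := (isCompact_stateSpace A).extremePoints_nonempty h
  let _ : PartialOrder A := CStarAlgebra.spectralOrder A
  have _ : StarOrderedRing A := CStarAlgebra.spectralOrderedRing A
  let f : A →ₚ[ℂ] ℂ := PositiveLinearMap.mk₀ (WeakDual.toStrongDual φ).toLinearMap fun x hx => by
    obtain ⟨a, rfl⟩ := CStarAlgebra.nonneg_iff_eq_star_mul_self.1 hx
    exact hφ.1.2.2 a
  -- The GNS vector ξ below is the class of 1. It is cyclic because its orbit is the image of the
  -- dense pre-GNS space, and its vector state is the extreme state φ.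
  have hf : ∀ a, f a = φ a := fun a => rfl
  let ξ : f.GNS := ((f.toPreGNS 1 : f.PreGNS) : f.GNS)
  have hπ : ∀ a, f.gnsStarAlgHom a ξ = ((f.toPreGNS a : f.PreGNS) : f.GNS) := fun a => by
    change f.gnsNonUnitalStarAlgHom a ((f.toPreGNS 1 : f.PreGNS) : f.GNS) = _
    rw [PositiveLinearMap.gnsNonUnitalStarAlgHom_apply_coe]
    congr 1
    simp
  have hin : ∀ a, ⟪ξ, f.gnsStarAlgHom a ξ⟫_ℂ = φ a := fun a => by
    rw [hπ, UniformSpace.Completion.inner_coe, PositiveLinearMap.preGNS_inner_def]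
    simp [hf]
  have hξ : ‖ξ‖ = 1 := by
    have := hin 1
    rw [map_one, one_apply_eq_self, inner_self_eq_ofReal_norm_sq, hφ.1.2.1] at this
    have h1 : ‖ξ‖ ^ 2 = 1 := by exact_mod_cast this
    exact (pow_eq_one_iff_of_nonneg (norm_nonneg _) two_ne_zero).1 h1
  refine ⟨f.GNS, inferInstance, inferInstance, inferInstance, f.gnsStarAlgHom,
    isIrreducibleRep_of_extreme _ (ξ := ξ) ?_ hξ ?_⟩
  · have : (fun a => f.gnsStarAlgHom a ξ) =
        (fun x : f.PreGNS => (x : f.GNS)) ∘ f.toPreGNS := funext hπ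
    rw [this, f.toPreGNS.surjective.range_comp]
    exact UniformSpace.Completion.denseRange_coe
  · have : StrongDual.toWeakDual (vectorFunctional f.gnsStarAlgHom ξ) = φ :=
      DFunLike.ext _ _ hin
    rwa [this]

namespace TwistedGroupCStarAlgebra

variable {G : Type u} [Group G] {σ : NormalizedTwoCocycle G Circle}

/-- The state is the vector state of the regular representation at the point mass at the identity.
It is bounded by the full norm on the twisted group algebra, so it extends to the completion. -/
theorem stateSpace_nonempty : (stateSpace (TwistedGroupCStarAlgebra σ)).Nonempty := by
  classical
  let π := TwistedGroupAlgebra.regularRep σ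
  let v : lp (fun _ : G => ℂ) 2 := lp.single 2 1 1
  have hv : ‖v‖ = 1 := by
    have : ‖v‖ = ‖(1 : ℂ)‖ := lp.norm_single (E := fun _ : G => ℂ) (by norm_num) 1 (1 : ℂ)
    rw [this, norm_one]
  let φ₀ : TwistedGroupAlgebra σ →ₗ[ℂ] ℂ :=
    { toFun := fun a => ⟪v, π a v⟫_ℂ
      map_add' := fun a b => by rw [map_add, add_apply, inner_add_right]
      map_smul' := fun c a => by
        rw [map_smul, smul_apply, inner_smul_right]; rfl }
  let e : TwistedGroupAlgebra σ →ₗ[ℂ] TwistedGroupCStarAlgebra σ :=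
    { toFun := of, map_add' := of_add, map_smul' := of_smul }
  have he : DenseRange e := UniformSpace.Completion.denseRange_coe
  have hb : ∀ a, ‖φ₀ a‖ ≤ 1 * ‖e a‖ := fun a => by
    change ‖⟪v, π a v⟫_ℂ‖ ≤ 1 * ‖of a‖
    rw [norm_of, one_mul]
    calc ‖⟪v, π a v⟫_ℂ‖ ≤ ‖v‖ * ‖π a v‖ := norm_inner_le_norm _ _
      _ ≤ ‖v‖ * (‖π a‖ * ‖v‖) := by gcongr; exact (π a).le_opNorm v
      _ = ‖π a‖ := by rw [hv, one_mul, mul_one]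
      _ ≤ ‖a‖ := TwistedGroupAlgebra.norm_rep_le π a
  let φ : TwistedGroupCStarAlgebra σ →L[ℂ] ℂ := φ₀.extendOfNorm e
  have hφ : ∀ a, φ (of a) = φ₀ a := fun a => LinearMap.extendOfNorm_eq he ⟨1, hb⟩ a
  refine ⟨StrongDual.toWeakDual φ, ?_, ?_, fun a => ?_⟩
  · exact mem_closedBall_zero_iff.2 (LinearMap.opNorm_extendOfNorm_le he zero_le_one hb)
  · change φ (of 1) = 1
    rw [hφ]
    change ⟪v, π 1 v⟫_ℂ = 1
    rw [map_one, one_apply_eq_self, inner_self_eq_ofReal_norm_sq, hv]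
    simp
  · change 0 ≤ φ (star a * a)
    induction a using TwistedGroupCStarAlgebra.induction with
    | hp =>
      exact isClosed_le continuous_const (φ.continuous.comp (continuous_star'.mul continuous_id))
    | ih a =>
      rw [star_of, ← of_mul, hφ]
      change 0 ≤ ⟪v, π (star a * a) v⟫_ℂ
      rw [map_mul, map_star, mul_apply_eq_comp, ContinuousLinearMap.star_eq_adjoint,
        ContinuousLinearMap.adjoint_inner_right, inner_self_eq_ofReal_norm_sq]
      exact_mod_cast sq_nonneg ‖π a v‖

end TwistedGroupCStarAlgebra

/-! ### From subhomogeneity to finite-dimensional representations and torsion -/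

/-- A representation on a nonzero finite-dimensional Hilbert space yields a unital
`*`-homomorphism to a matrix algebra. -/
theorem HasFiniteDimensionalRep.of_finiteDimensional {A : Type u} [CStarAlgebra A] {H : Type v}
    [NormedAddCommGroup H] [InnerProductSpace ℂ H] [CompleteSpace H] [FiniteDimensional ℂ H]
    [Nontrivial H] (π : A →⋆ₐ[ℂ] (H →L[ℂ] H)) : HasFiniteDimensionalRep A := by
  let b := stdOrthonormalBasis ℂ H
  let T : (H →L[ℂ] H) →⋆ₐ[ℂ] (H →ₗ[ℂ] H) :=
    { toFun := fun f => f.toLinearMap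
      map_one' := rfl
      map_mul' := fun _ _ => rfl
      map_zero' := rfl
      map_add' := fun _ _ => rfl
      commutes' := fun _ => rfl
      map_star' := fun _ => rfl }
  exact ⟨Module.finrank ℂ H, Module.finrank_pos,
    ⟨((LinearMap.toMatrixOrthonormal b : (H →ₗ[ℂ] H) ≃⋆ₐ[ℂ] _) : _ →⋆ₐ[ℂ] _).comp (T.comp π)⟩⟩

/-- A bound on irreducible dimensions says nothing unless an irreducible representation exists; that
existence is the content here. -/
theorem HasFiniteDimensionalRep.of_isSubhomogeneous {G : Type u} [Group G]
    {σ : NormalizedTwoCocycle G Circle} (h : IsSubhomogeneous (TwistedGroupCStarAlgebra σ)) :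
    HasFiniteDimensionalRep (TwistedGroupCStarAlgebra σ) := by
  obtain ⟨n, hn⟩ := h
  obtain ⟨H, _, _, _, π, hπ⟩ :=
    exists_isIrreducibleRep (TwistedGroupCStarAlgebra.stateSpace_nonempty (σ := σ))
  have := hπ.1
  have : FiniteDimensional ℂ H :=
    Module.rank_lt_aleph0_iff.1 ((hn H π hπ).trans_lt (Cardinal.natCast_lt_aleph0))
  exact .of_finiteDimensional π

/-- The determinant of a finite-dimensional representation shows that the class of the cocycle is
torsion. -/
theorem isOfFinOrder_cls_of_hasFiniteDimensionalRep {G : Type u} [Group G]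
    {σ : NormalizedTwoCocycle G Circle}
    (h : HasFiniteDimensionalRep (TwistedGroupCStarAlgebra σ)) : IsOfFinOrder σ.cls := by
  obtain ⟨n, hn, ⟨ψ⟩⟩ := h
  let U : G → Matrix (Fin n) (Fin n) ℂ := fun g =>
    ψ (TwistedGroupCStarAlgebra.of (TwistedGroupAlgebra.single σ g 1))
  have hmul : ∀ g h, U g * U h = (σ.1.1 g h : ℂ) • U (g * h) := fun g h => by
    simp only [U]
    rw [← map_mul, ← TwistedGroupCStarAlgebra.of_mul, TwistedGroupAlgebra.single_mul_single,
      ← map_smul, ← TwistedGroupCStarAlgebra.of_smul, TwistedGroupAlgebra.smul_single]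
    simp
  have hstar : ∀ g, star (U g) * U g = 1 := fun g => by
    simp only [U]
    rw [← map_star, ← map_mul, TwistedGroupCStarAlgebra.star_of, ← TwistedGroupCStarAlgebra.of_mul,
      TwistedGroupAlgebra.star_single_mul_single, star_one, mul_one, one_smul]
    exact map_one ψ
  have hdet : ∀ g, ‖(U g).det‖ = 1 := fun g => by
    have : star (U g).det * (U g).det = 1 := by
      rw [← Matrix.det_conjTranspose, ← Matrix.det_mul, ← Matrix.star_eq_conjTranspose, hstar,
        Matrix.det_one]
    have h2 := congrArg norm this
    rw [norm_mul, norm_star, norm_one] at h2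
    nlinarith [norm_nonneg (U g).det]
  let γ : G → Circle := fun g => ⟨(U g).det, mem_sphere_zero_iff_norm.2 (hdet g)⟩
  refine isOfFinOrder_iff_pow_eq_one.2 ⟨n, hn, (H2.mk_eq_one_iff (σ.1 ^ n)).2 ⟨γ, fun g h => ?_⟩⟩
  change σ.1.1 g h ^ n = _
  have key : γ g * γ h = σ.1.1 g h ^ n * γ (g * h) := by
    apply Circle.ext
    have := congrArg Matrix.det (hmul g h)
    rw [Matrix.det_mul, Matrix.det_smul, Fintype.card_fin] at this
    rw [Circle.coe_mul, Circle.coe_mul, Circle.coe_pow]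
    exact this
  rw [mul_right_comm, key, mul_inv_cancel_right]

open Polynomial

/-! ### Schur's lemma -/

section Schur

variable {A : Type u} [CStarAlgebra A] {H : Type v} [NormedAddCommGroup H]
  [InnerProductSpace ℂ H] [CompleteSpace H] {π : A →⋆ₐ[ℂ] (H →L[ℂ] H)}

/-- In the commutant of an irreducible representation there are no zero divisors. -/
theorem IsIrreducibleRep.eq_zero_or_eq_zero_of_mul_eq_zero (hπ : IsIrreducibleRep π)
    {S T : H →L[ℂ] H} (hS : ∀ a, Commute S (π a)) (hST : S * T = 0) : S = 0 ∨ T = 0 := by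
  -- The kernel of an operator in the commutant is a closed invariant subspace, and it contains the
  -- range of `T`.
  rcases hπ.2 (LinearMap.ker S.toLinearMap) S.isClosed_ker (fun a x hx => by
    change S (π a x) = 0
    have h1 : S (π a x) = π a (S x) := DFunLike.congr_fun (hS a) x
    have h2 : S x = 0 := hx
    rw [h1, h2, map_zero]) with h | h
  · right
    ext x
    have : T x ∈ LinearMap.ker S.toLinearMap := DFunLike.congr_fun hST x
    rw [h] at this
    exact this
  · left
    ext x
    have : x ∈ LinearMap.ker S.toLinearMap := h ▸ Submodule.mem_top
    exact this

/-- Two distinct spectral points would give, by functional calculus, two nonzero elements of the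
commutant with product zero. So the spectrum has at most one point. -/
theorem IsIrreducibleRep.eq_algebraMap_of_isSelfAdjoint (hπ : IsIrreducibleRep π)
    {T : H →L[ℂ] H} (hsa : IsSelfAdjoint T) (hT : ∀ a, Commute T (π a)) :
    ∃ c : ℝ, T = algebraMap ℝ (H →L[ℂ] H) c := by
  have hsub : ∀ a ∈ spectrum ℝ T, ∀ b ∈ spectrum ℝ T, ¬ a < b := by
    intro a ha b hb hab
    -- The functions `f` and `g` live on opposite sides of the midpoint, so their product vanishes,
    -- while f(b) > 0 and g(a) > 0.
    let f : ℝ → ℝ := fun t => max 0 (t - (a + b) / 2)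
    let g : ℝ → ℝ := fun t => max 0 ((a + b) / 2 - t)
    have hf : Continuous f := by fun_prop
    have hg : Continuous g := by fun_prop
    have hfg : cfc f T * cfc g T = 0 := by
      rw [← cfc_mul f g T hf.continuousOn hg.continuousOn, ← cfc_zero ℝ T]
      congr 1
      ext t
      change max 0 (t - (a + b) / 2) * max 0 ((a + b) / 2 - t) = 0
      rcases le_total t ((a + b) / 2) with h | h
      · rw [max_eq_left (by linarith : t - (a + b) / 2 ≤ 0), zero_mul]
      · rw [max_eq_left (by linarith : (a + b) / 2 - t ≤ 0), mul_zero]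
    have heq : ∀ h : ℝ → ℝ, Continuous h → cfc h T = 0 → ∀ t ∈ spectrum ℝ T, h t = 0 := by
      intro h hh h0 t ht
      rw [← cfc_zero ℝ T] at h0
      exact (cfc_eq_cfc_iff_eqOn (hf := hh.continuousOn) (hg := continuousOn_const)).1 h0 ht
    rcases hπ.eq_zero_or_eq_zero_of_mul_eq_zero (fun c => (hT c).cfc_real f) hfg with h | h
    · have := heq f hf h b hb
      simp only [f, max_eq_left_iff] at this
      linarith
    · have := heq g hg h a ha
      simp only [g, max_eq_left_iff] at this
      linarith
  obtain ⟨c, hc⟩ : ∃ c, ∀ t ∈ spectrum ℝ T, t = c := by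
    rcases (spectrum ℝ T).eq_empty_or_nonempty with h | ⟨c, hc⟩
    · exact ⟨0, by simp [h]⟩
    · exact ⟨c, fun t ht => le_antisymm (not_lt.1 (hsub c hc t ht)) (not_lt.1 (hsub t ht c hc))⟩
  refine ⟨c, ?_⟩
  rw [← cfc_const c T, ← cfc_id ℝ T]
  conv_rhs => rw [cfc_id ℝ T]
  exact cfc_congr fun t ht => hc t ht

/-- Schur's lemma: the commutant of an irreducible representation consists of scalars. -/
theorem IsIrreducibleRep.eq_algebraMap_of_commute (hπ : IsIrreducibleRep π)
    {T : H →L[ℂ] H} (hT : ∀ a, Commute T (π a)) : ∃ c : ℂ, T = algebraMap ℂ (H →L[ℂ] H) c := by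
  have hT' : ∀ a, Commute (star T) (π a) := fun a => by
    have := (hT (star a)).star_star
    rwa [map_star, star_star] at this
  obtain ⟨x, hx⟩ := hπ.eq_algebraMap_of_isSelfAdjoint (realPart T).2 fun a => by
    rw [realPart_apply_coe]
    exact ((hT a).add_left (hT' a)).smul_left _
  obtain ⟨y, hy⟩ := hπ.eq_algebraMap_of_isSelfAdjoint (imaginaryPart T).2 fun a => by
    rw [imaginaryPart_apply_coe]
    exact (((hT a).sub_left (hT' a)).smul_left _).smul_left _
  refine ⟨x + Complex.I * y, ?_⟩
  rw [← realPart_add_I_smul_imaginaryPart T, hx, hy, map_add, map_mul,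
    Algebra.smul_def, IsScalarTower.algebraMap_apply ℝ ℂ (H →L[ℂ] H),
    IsScalarTower.algebraMap_apply ℝ ℂ (H →L[ℂ] H)]
  rfl

end Schur

/-! ### Algebraicity and joint eigenvectors -/

/-- An element of a finite family that is permuted by a set of endomorphisms whose common fixed
points are scalars is algebraic. -/
theorem exists_monic_aeval_eq_zero_of_permuted {k : Type u} [CommRing k] {D : Type v} [CommRing D]
    [Algebra k D] {ι : Type w} [Fintype ι] (a : ι → D) {J : Type*} (α : J → D →ₐ[k] D)
    (e : J → Equiv.Perm ι) (hα : ∀ j i, α j (a i) = a (e j i))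
    (hfix : ∀ d, (∀ j, α j d = d) → ∃ c, d = algebraMap k D c) (i : ι) :
    ∃ p : k[X], p.Monic ∧ aeval (a i) p = 0 := by
  -- Each `α j` permutes the roots, hence fixes the coefficients of `P`, which are therefore
  -- scalars. Thus `P` descends to a polynomial over `k` annihilating every `a i`.
  let P : D[X] := ∏ i, (X - C (a i))
  have hP : ∀ j, P.map (α j : D →+* D) = P := fun j => by
    simp only [P, Polynomial.map_prod, Polynomial.map_sub, map_X, map_C]
    rw [← Equiv.prod_comp (e j) fun i => X - C (a i)]
    exact Finset.prod_congr rfl fun i _ => by rw [← hα]; rfl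
  have hlift : P ∈ lifts (algebraMap k D) := (lifts_iff_coeff_lifts _).2 fun n => by
    obtain ⟨c, hc⟩ := hfix (P.coeff n) fun j => by
      conv_rhs => rw [← hP j]
      rw [coeff_map]; rfl
    exact ⟨c, hc.symm⟩
  obtain ⟨p, hp, -, hm⟩ := lifts_and_natDegree_eq_and_monic hlift (monic_prod_X_sub_C _ _)
  refine ⟨p, hm, ?_⟩
  rw [← eval_map_algebraMap, hp, eval_prod]
  exact Finset.prod_eq_zero (Finset.mem_univ i) (by simp)

/-- A root c of p either has x as an eigenvector, or x can be replaced by the nonzero vector (f -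
c)x of `W`, annihilated by a polynomial of smaller degree. No finite-dimensionality is needed. -/
theorem Module.End.exists_eigenvector_mem {k : Type u} [Field k] [IsAlgClosed k] {V : Type v}
    [AddCommGroup V] [Module k V] (f : Module.End k V) (W : Submodule k V)
    (hW : ∀ x ∈ W, f x ∈ W) : ∀ (n : ℕ) (p : k[X]), p ≠ 0 → p.natDegree = n → ∀ x ∈ W, x ≠ 0 →
      aeval f p x = 0 → ∃ y ∈ W, y ≠ 0 ∧ ∃ c : k, f y = c • y := by
  intro n
  induction n with
  | zero =>
    intro p hp hn x _ hx0 hpx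
    rw [eq_C_of_natDegree_eq_zero hn, aeval_C, Module.algebraMap_end_apply] at hpx
    rw [eq_C_of_natDegree_eq_zero hn, Ne, C_eq_zero] at hp
    exact absurd hpx (smul_ne_zero hp hx0)
  | succ n ih =>
    intro p hp hn x hx hx0 hpx
    obtain ⟨c, hc⟩ := IsAlgClosed.exists_root p fun h => by
      rw [natDegree_eq_of_degree_eq_some (n := 0) h] at hn
      omega
    obtain ⟨q, rfl⟩ := dvd_iff_isRoot.2 hc
    have hq : q ≠ 0 := right_ne_zero_of_mul hp
    by_cases hy : f x - c • x = 0
    · exact ⟨x, hx, hx0, c, sub_eq_zero.1 hy⟩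
    refine ih q hq ?_ (f x - c • x) (W.sub_mem (hW x hx) (W.smul_mem c hx)) hy ?_
    · rw [natDegree_mul (X_sub_C_ne_zero c) hq, natDegree_X_sub_C] at hn
      omega
    · rw [mul_comm, map_mul, Module.End.mul_apply] at hpx
      simpa [Module.algebraMap_end_apply] using hpx

/-- Finitely many commuting algebraic endomorphisms have a joint eigenvector. -/
theorem Module.End.exists_joint_eigenvector {k : Type u} [Field k] [IsAlgClosed k] {V : Type v}
    [AddCommGroup V] [Module k V] [Nontrivial V] {ι : Type w} (f : ι → Module.End k V)
    (hcomm : ∀ i j, Commute (f i) (f j)) (halg : ∀ i, ∃ p : k[X], p.Monic ∧ aeval (f i) p = 0)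
    (s : Finset ι) : ∃ x : V, x ≠ 0 ∧ ∀ i ∈ s, ∃ c : k, f i x = c • x := by
  classical
  suffices h : ∃ c : ι → k, ∃ x : V, x ≠ 0 ∧ ∀ i ∈ s, f i x = c i • x by
    obtain ⟨c, x, hx, h⟩ := h
    exact ⟨x, hx, fun i hi => ⟨c i, h i hi⟩⟩
  induction s using Finset.induction_on with
  | empty =>
    obtain ⟨x, hx⟩ := exists_ne (0 : V)
    exact ⟨0, x, hx, by simp⟩
  | insert j s hj ih =>
    obtain ⟨c, x, hx, h⟩ := ih
    -- The joint eigenspace for the eigenvalues found so far is preserved by `f j` because the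
    -- endomorphisms commute, so the next eigenvector can be sought inside it.
    let W : Submodule k V := ⨅ i ∈ s, LinearMap.ker (f i - algebraMap k _ (c i))
    have hmem : ∀ y, y ∈ W ↔ ∀ i ∈ s, f i y = c i • y := fun y => by
      simp [W, Submodule.mem_iInf, sub_eq_zero, Module.algebraMap_end_apply]
    obtain ⟨p, hp, hpf⟩ := halg j
    obtain ⟨y, hy, hy0, d, hd⟩ := (f j).exists_eigenvector_mem W (fun y hy => by
      rw [hmem] at hy ⊢
      intro i hi
      have : f i (f j y) = f j (f i y) := DFunLike.congr_fun (hcomm i j) y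
      rw [this, hy i hi, map_smul]) _ p hp.ne_zero rfl x ((hmem x).2 h) hx (by rw [hpf]; rfl)
    refine ⟨Function.update c j d, y, hy0, fun i hi => ?_⟩
    rcases Finset.mem_insert.1 hi with rfl | hi
    · rw [Function.update_self, hd]
    · rw [Function.update_of_ne (ne_of_mem_of_not_mem hi hj), (hmem y).1 hy i hi]

/-! ### Projective representations -/

/-- A family `U` of elements of an algebra with `U g * U h = ω(g, h) • U (g * h)` and `U 1 = 1`. -/
structure IsProjectiveRep {G : Type u} [Group G] {k : Type v} [Field k] {R : Type w} [Ring R]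
    [Algebra k R] (ω : G → G → k) (U : G → R) : Prop where
  ne_zero : ∀ g h, ω g h ≠ 0
  map_one : U 1 = 1
  map_mul : ∀ g h, U g * U h = ω g h • U (g * h)

/-- Conjugation by a unit, as an algebra endomorphism. -/
def Units.conjAlgHom (k : Type v) [CommSemiring k] {R : Type w} [Semiring R] [Algebra k R]
    (u : Rˣ) : R →ₐ[k] R where
  toFun x := u * x * ↑u⁻¹
  map_one' := by simp
  map_mul' x y := by simp [mul_assoc]
  map_zero' := by simp
  map_add' x y := by rw [mul_add, add_mul]
  commutes' c := by rw [← Algebra.commutes, mul_assoc, Units.mul_inv, mul_one]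

theorem Units.conjAlgHom_eq_iff {k : Type v} [CommSemiring k] {R : Type w} [Semiring R]
    [Algebra k R] (u : Rˣ) (x y : R) : u.conjAlgHom k x = y ↔ u * x = y * u :=
  Units.mul_inv_eq_iff_eq_mul u

namespace IsProjectiveRep

variable {G : Type u} [Group G] {k : Type v} [Field k] {R : Type w} [Ring R] [Algebra k R]
  {ω : G → G → k} {U : G → R}

theorem map_mul_eq_smul (hU : IsProjectiveRep ω U) (g h : G) :
    U (g * h) = (ω g h)⁻¹ • (U g * U h) := by
  rw [hU.map_mul, smul_smul, inv_mul_cancel₀ (hU.ne_zero g h), one_smul]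

theorem isUnit (hU : IsProjectiveRep ω U) (g : G) : IsUnit (U g) := by
  refine isUnit_iff_exists_and_exists.2 ⟨⟨(ω g g⁻¹)⁻¹ • U g⁻¹, ?_⟩, ⟨(ω g⁻¹ g)⁻¹ • U g⁻¹, ?_⟩⟩
  · rw [mul_smul_comm, ← hU.map_mul_eq_smul, mul_inv_cancel, hU.map_one]
  · rw [smul_mul_assoc, ← hU.map_mul_eq_smul, inv_mul_cancel, hU.map_one]

/-- Conjugation by `U g`. -/
def conj (hU : IsProjectiveRep ω U) (g : G) : R →ₐ[k] R := (hU.isUnit g).unit.conjAlgHom k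

theorem conj_eq_iff (hU : IsProjectiveRep ω U) (g : G) (x y : R) :
    hU.conj g x = y ↔ U g * x = y * U g :=
  Units.conjAlgHom_eq_iff _ x y

theorem mul_eq_conj_mul (hU : IsProjectiveRep ω U) (g : G) (x : R) :
    U g * x = hU.conj g x * U g :=
  (hU.conj_eq_iff g x _).1 rfl

theorem conj_conj (hU : IsProjectiveRep ω U) (g h : G) (x : R) :
    hU.conj g (hU.conj h x) = hU.conj (g * h) x := by
  symm
  rw [conj_eq_iff, hU.map_mul_eq_smul, smul_mul_assoc, mul_smul_comm, mul_assoc,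
    hU.mul_eq_conj_mul h, ← mul_assoc, hU.mul_eq_conj_mul g, mul_assoc]

/-- Conjugation permutes the lines spanned by the operators. For normal `M` it therefore preserves
the algebra they generate over `M`. -/
theorem conj_apply (hU : IsProjectiveRep ω U) (g h : G) :
    ∃ c : k, hU.conj g (U h) = c • U (g * h * g⁻¹) := by
  refine ⟨ω g h * (ω (g * h * g⁻¹) g)⁻¹, ?_⟩
  rw [conj_eq_iff, smul_mul_assoc, hU.map_mul, hU.map_mul, inv_mul_cancel_right, smul_smul,
    inv_mul_cancel_right₀ (hU.ne_zero _ _)]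

/-- If the operators of a normal subgroup of finite index commute and only scalars commute with
the whole representation, then the operators of the subgroup are algebraic. -/
theorem exists_monic_aeval_eq_zero (hU : IsProjectiveRep ω U) (M : Subgroup G) [M.Normal]
    [M.FiniteIndex] (hM : ∀ x ∈ M, ∀ y ∈ M, Commute (U x) (U y))
    (hfix : ∀ x : R, (∀ g, Commute (U g) x) → ∃ c, x = algebraMap k R c) {m : G} (hm : m ∈ M) :
    ∃ p : k[X], p.Monic ∧ aeval (U m) p = 0 := by
  let D : Subalgebra k R := Algebra.adjoin k (U '' M)
  have hcomm : IsMulCommutative D := Algebra.isMulCommutative_adjoin k (by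
    rintro _ ⟨x, hx, rfl⟩ _ ⟨y, hy, rfl⟩
    exact hM x hx y hy)
  have hUD : ∀ x ∈ M, U x ∈ D := fun x hx => Algebra.subset_adjoin ⟨x, hx, rfl⟩
  have hconj : ∀ g, ∀ x ∈ D, hU.conj g x ∈ D := fun g => by
    change D ≤ D.comap (hU.conj g)
    refine Algebra.adjoin_le ?_
    rintro _ ⟨x, hx, rfl⟩
    obtain ⟨c, hc⟩ := hU.conj_apply g x
    change hU.conj g (U x) ∈ D
    rw [hc]
    exact D.smul_mem (hUD _ (Subgroup.Normal.conj_mem inferInstance x hx g)) c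
  let α : G → D →ₐ[k] D := fun g =>
    ((hU.conj g).comp D.val).codRestrict D fun x => hconj g x x.2
  have hα : ∀ g x, ((α g x : D) : R) = hU.conj g x := fun g x => rfl
  -- Since `D` is commutative, `M` acts trivially on it and the conjugates of `U m` depend only on
  -- cosets of `M`. This makes the permuted family finite.
  have hαM : ∀ g ∈ M, ∀ x : D, α g x = x := fun g hg x => by
    apply Subtype.ext
    rw [hα, conj_eq_iff]
    exact congrArg Subtype.val (mul_comm' (⟨U g, hUD g hg⟩ : D) x)
  let _ : CommRing D := { (inferInstance : Ring D) with mul_comm := mul_comm' }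
  have := Fintype.ofFinite (G ⧸ M)
  obtain ⟨p, hp, hpm⟩ := exists_monic_aeval_eq_zero_of_permuted (k := k) (D := D)
    (fun q : G ⧸ M => α q.out ⟨U m, hUD m hm⟩) α (fun g => MulAction.toPerm g) (fun g q => by
      obtain ⟨n, hn⟩ := QuotientGroup.mk_out_eq_mul M (g * q.out)
      have h1 : (g • q).out = g * q.out * n := by
        rw [← hn]
        congr 1
        conv_lhs => rw [← q.out_eq]
        rfl
      apply Subtype.ext
      change _ = ((α (g • q).out ⟨U m, hUD m hm⟩ : D) : R)
      rw [hα, hα, hα, conj_conj, h1, ← conj_conj _ _ n.1]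
      refine congrArg (hU.conj _) ?_
      exact (congrArg Subtype.val (hαM n n.2 ⟨U m, hUD m hm⟩)).symm)
    (fun d hd => by
      obtain ⟨c, hc⟩ := hfix d fun g =>
        (hU.conj_eq_iff g _ _).1 (congrArg Subtype.val (hd g))
      exact ⟨c, Subtype.ext hc⟩)
    ((1 : G) : G ⧸ M)
  -- The chosen representative of the trivial coset need not be 1, but it lies in `M`, so the member
  -- of the family at that coset is `U m` itself.
  have h1 : ((1 : G) : G ⧸ M).out ∈ M := (QuotientGroup.eq_one_iff _).1 (Quotient.out_eq _)
  simp only [hαM _ h1] at hpm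
  refine ⟨p, hp, ?_⟩
  have := congrArg D.val hpm
  rw [map_zero, ← aeval_algHom_apply] at this
  exact this

/-- If `v` is a joint eigenvector for a subgroup `M`, then the translates of `v` by coset
representatives of `M` span an invariant subspace. -/
theorem map_mem_span {V : Type w} [AddCommGroup V] [Module k V] {U : G → Module.End k V}
    (hU : IsProjectiveRep ω U) (M : Subgroup G) {x : V}
    (hx : ∀ m ∈ M, ∃ c : k, U m x = c • x) (g : G) {y : V}
    (hy : y ∈ Submodule.span k (Set.range fun q : G ⧸ M => U q.out x)) :
    U g y ∈ Submodule.span k (Set.range fun q : G ⧸ M => U q.out x) := by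
  have hgx : ∀ h : G, U h x ∈ Submodule.span k (Set.range fun q : G ⧸ M => U q.out x) := by
    intro h
    obtain ⟨m, hm⟩ := QuotientGroup.mk_out_eq_mul M h
    -- The factor from `M` only rescales x, so `U h x` is a multiple of the translate by the coset
    -- representative.
    have h1 : h = (h : G ⧸ M).out * (m : G)⁻¹ := by rw [hm, mul_inv_cancel_right]
    obtain ⟨c, hc⟩ := hx _ (M.inv_mem m.2)
    rw [h1, hU.map_mul_eq_smul]
    rw [LinearMap.smul_apply, Module.End.mul_apply, hc, map_smul]
    exact Submodule.smul_mem _ _ (Submodule.smul_mem _ _ (Submodule.subset_span ⟨(h : G ⧸ M), rfl⟩))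
  induction hy using Submodule.span_induction with
  | mem y hy =>
    obtain ⟨q, rfl⟩ := hy
    change (U g * U q.out) x ∈ _
    rw [hU.map_mul]
    exact Submodule.smul_mem _ _ (hgx _)
  | zero => rw [map_zero]; exact Submodule.zero_mem _
  | add y z _ _ hy hz => rw [map_add]; exact Submodule.add_mem _ hy hz
  | smul c y _ hy => rw [map_smul]; exact Submodule.smul_mem _ _ hy

/-- A joint eigenvector for generators of a subgroup is a joint eigenvector for the subgroup. -/
theorem exists_eigenvalue_of_closure {V : Type w} [AddCommGroup V] [Module k V]
    {U : G → Module.End k V} (hU : IsProjectiveRep ω U) {S : Set G} {x : V}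
    (hx : ∀ m ∈ S, ∃ c : k, U m x = c • x) {m : G} (hm : m ∈ Subgroup.closure S) :
    ∃ c : k, U m x = c • x := by
  induction hm using Subgroup.closure_induction with
  | mem m hm => exact hx m hm
  | one => exact ⟨1, by rw [hU.map_one, one_smul]; rfl⟩
  | mul g h _ _ hg hh =>
    obtain ⟨c, hc⟩ := hg
    obtain ⟨d, hd⟩ := hh
    refine ⟨(ω g h)⁻¹ * (d * c), ?_⟩
    rw [hU.map_mul_eq_smul, LinearMap.smul_apply, Module.End.mul_apply, hd, map_smul, hc,
      smul_smul, smul_smul, mul_assoc]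
  | inv g _ hg =>
    obtain ⟨c, hc⟩ := hg
    have key : c • U g⁻¹ x = ω g⁻¹ g • x := by
      rw [← map_smul, ← hc, ← Module.End.mul_apply, hU.map_mul, inv_mul_cancel, hU.map_one]
      rfl
    -- A zero eigenvalue would force x = 0, since `U g` is invertible; x is not assumed nonzero.
    by_cases hc0 : c = 0
    · rw [hc0, zero_smul] at key
      have : x = 0 := (smul_eq_zero.1 key.symm).resolve_left (hU.ne_zero _ _)
      exact ⟨0, by rw [this, map_zero, smul_zero]⟩
    · exact ⟨c⁻¹ * ω g⁻¹ g, by rw [mul_smul, ← key, smul_smul, inv_mul_cancel₀ hc0, one_smul]⟩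

end IsProjectiveRep

/-! ### Subhomogeneity of type I classes -/

namespace TwistedGroupCStarAlgebra

variable {G : Type u} [Group G] {σ : NormalizedTwoCocycle G Circle}
  {H : Type v} [NormedAddCommGroup H] [InnerProductSpace ℂ H] [CompleteSpace H]
  (π : TwistedGroupCStarAlgebra σ →⋆ₐ[ℂ] (H →L[ℂ] H))

theorem isProjectiveRep_map :
    IsProjectiveRep (fun g h => (σ.1.1 g h : ℂ))
      (fun g => π (of (TwistedGroupAlgebra.single σ g 1))) where
  ne_zero g h := Circle.coe_ne_zero _
  map_one := map_one π
  map_mul g h := by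
    rw [← _root_.map_mul, ← of_mul, TwistedGroupAlgebra.single_mul_single, ← _root_.map_smul,
      ← of_smul, TwistedGroupAlgebra.smul_single]
    simp

theorem map_continuous : Continuous π :=
  AddMonoidHomClass.continuous_of_bound π 1 fun a => by
    rw [one_mul]
    exact NonUnitalStarAlgHom.norm_apply_le π a

/-- A closed linear condition on the values of a representation may be checked on the canonical
unitaries. -/
theorem map_mem_of_forall_single {L : Submodule ℂ (H →L[ℂ] H)} (hL : IsClosed (L : Set (H →L[ℂ] H)))
    (h : ∀ g, π (of (TwistedGroupAlgebra.single σ g 1)) ∈ L) (a : TwistedGroupCStarAlgebra σ) :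
    π a ∈ L := by
  induction a using TwistedGroupCStarAlgebra.induction with
  | hp => exact hL.preimage (map_continuous π)
  | ih a =>
    induction a using TwistedGroupAlgebra.induction with
    | h0 =>
      have : of (0 : TwistedGroupAlgebra σ) = 0 := by simpa using of_smul (σ := σ) 0 0
      rw [this, map_zero]
      exact L.zero_mem
    | hadd a b ha hb => rw [of_add, map_add]; exact L.add_mem ha hb
    | hs g x =>
      have : TwistedGroupAlgebra.single σ g x = x • TwistedGroupAlgebra.single σ g 1 := by
        rw [TwistedGroupAlgebra.smul_single, mul_one]
      rw [this, of_smul, map_smul]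
      exact L.smul_mem x (h g)

/-- If `σ` is symmetric on a finitely generated abelian normal subgroup `M` of finite index, the
irreducible representations of `C*(G, σ)` have dimension at most the index of `M`. -/
theorem rank_le_of_isIrreducibleRep {π : TwistedGroupCStarAlgebra σ →⋆ₐ[ℂ] (H →L[ℂ] H)}
    (hπ : IsIrreducibleRep π) (M : Subgroup G) [M.Normal] [M.FiniteIndex] (hfg : M.FG)
    (hM : ∀ x ∈ M, ∀ y ∈ M, x * y = y * x ∧ σ.1.1 x y = σ.1.1 y x) :
    Module.rank ℂ H ≤ (M.index : Cardinal.{v}) := by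
  classical
  have := hπ.1
  have hU := isProjectiveRep_map π
  have hMU : ∀ x ∈ M, ∀ y ∈ M, Commute (π (of (TwistedGroupAlgebra.single σ x 1)))
      (π (of (TwistedGroupAlgebra.single σ y 1))) := fun x hx y hy => by
    refine (hU.map_mul x y).trans ((hU.map_mul y x).trans ?_).symm
    rw [(hM x hx y hy).1, (hM x hx y hy).2]
  let T : (H →L[ℂ] H) →ₐ[ℂ] Module.End ℂ H :=
    { toFun := fun f => f.toLinearMap
      map_one' := rfl
      map_mul' := fun _ _ => rfl
      map_zero' := rfl
      map_add' := fun _ _ => rfl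
      commutes' := fun _ => rfl }
  let U : G → Module.End ℂ H := fun g => T (π (of (TwistedGroupAlgebra.single σ g 1)))
  have hU' : IsProjectiveRep (fun g h => (σ.1.1 g h : ℂ)) U :=
    ⟨hU.ne_zero, by simp only [U]; rw [hU.map_one, map_one], fun g h => by
      simp only [U]; rw [← map_mul, hU.map_mul, map_smul]⟩
  have halg : ∀ m : M, ∃ p : ℂ[X], p.Monic ∧ aeval (U m) p = 0 := fun m => by
    -- An operator commuting with the canonical unitaries commutes with the whole image, its
    -- centralizer being closed. Schur's lemma then makes it scalar.
    obtain ⟨p, hp, hpm⟩ := hU.exists_monic_aeval_eq_zero M hMU (fun x hx => by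
      refine hπ.eq_algebraMap_of_commute fun a => ?_
      have hcl : IsClosed ((Subalgebra.centralizer ℂ {x} : Subalgebra ℂ (H →L[ℂ] H)) :
          Set (H →L[ℂ] H)) := Set.isClosed_centralizer _
      have := map_mem_of_forall_single π
        (L := Subalgebra.toSubmodule (Subalgebra.centralizer ℂ {x})) hcl (fun g => by
          change _ ∈ Subalgebra.centralizer ℂ {x}
          rw [Subalgebra.mem_centralizer_iff]
          rintro _ rfl
          exact (hx g).symm) a
      exact (Subalgebra.mem_centralizer_iff ℂ).1 this x rfl) m.2
    refine ⟨p, hp, ?_⟩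
    rw [aeval_algHom_apply, hpm, map_zero]
  obtain ⟨S, hS⟩ := hfg
  have hSM : ∀ s ∈ S, s ∈ M := fun s hs => hS ▸ Subgroup.subset_closure hs
  obtain ⟨x, hx0, hx⟩ := Module.End.exists_joint_eigenvector (fun m : M => U m)
    (fun m n => (hMU m m.2 n n.2).map T) halg (S.subtype (· ∈ M))
  have hxM : ∀ m ∈ M, ∃ c : ℂ, U m x = c • x := fun m hm => by
    rw [← hS] at hm
    refine hU'.exists_eigenvalue_of_closure (fun s hs => ?_) hm
    exact hx ⟨s, hSM s hs⟩ (Finset.mem_subtype.2 hs)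
  -- One spanning vector per coset bounds the dimension by the index. Finite-dimensionality makes
  -- `W` closed, so irreducibility applies, and `W` is nonzero because it contains the image of x
  -- under an invertible operator.
  let W : Submodule ℂ H := Submodule.span ℂ (Set.range fun q : G ⧸ M => U q.out x)
  have := Fintype.ofFinite (G ⧸ M)
  have hWfin : FiniteDimensional ℂ W := FiniteDimensional.span_of_finite ℂ (Set.finite_range _)
  have hWcl : IsClosed (W : Set H) := W.closed_of_finiteDimensional
  have hinv : ∀ a, ∀ y ∈ W, π a y ∈ W := fun a y hy => by
    let E : (H →L[ℂ] H) →L[ℂ] H := ContinuousLinearMap.apply ℂ H y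
    exact map_mem_of_forall_single π (L := W.comap E.toLinearMap) (hWcl.preimage E.continuous)
      (fun g => hU'.map_mem_span M hxM g hy) a
  have hWtop : W = ⊤ := (hπ.2 W hWcl hinv).resolve_left fun h => by
    have hmem : U ((1 : G) : G ⧸ M).out x ∈ W := Submodule.subset_span ⟨_, rfl⟩
    rw [h, Submodule.mem_bot] at hmem
    have hinj := ((Module.End.isUnit_iff _).1 (hU'.isUnit ((1 : G) : G ⧸ M).out)).1
    exact hx0 (hinj (hmem.trans (map_zero _).symm))
  rw [← rank_top, ← hWtop]
  refine (rank_span_le _).trans ?_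
  have h1 := Cardinal.mk_range_le_lift (f := fun q : G ⧸ M => U q.out x)
  rw [← Nat.cast_card (α := G ⧸ M)] at h1
  simpa [Subgroup.index] using h1

end TwistedGroupCStarAlgebra

/-- A coboundary is symmetric on commuting elements. The normal core of `K ⊓ N` is therefore a
normal abelian subgroup of finite index, hence finitely generated, on which σ is symmetric. -/
theorem IsSubhomogeneous.of_isTypeI {G : Type u} [Group G] (hfg : Group.FG G)
    (hva : IsVirtuallyAbelian G) {σ : NormalizedTwoCocycle G Circle} (h : σ.cls.IsTypeI) :
    IsSubhomogeneous (TwistedGroupCStarAlgebra σ) := by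
  obtain ⟨K, hK, hKcomm⟩ := hva
  obtain ⟨N, hN, hNtriv⟩ := h
  obtain ⟨γ, hγ⟩ := (H2.mk_eq_one_iff _).1 hNtriv
  have hle : (K ⊓ N).normalCore ≤ K ⊓ N := Subgroup.normalCore_le _
  have hfgM : Group.FG (K ⊓ N).normalCore := inferInstance
  refine ⟨(K ⊓ N).normalCore.index, fun H _ _ _ π hπ =>
    TwistedGroupCStarAlgebra.rank_le_of_isIrreducibleRep hπ (K ⊓ N).normalCore
      ((Group.fg_iff_subgroup_fg _).1 hfgM) fun x hx y hy => ?_⟩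
  have hxy := hKcomm x (hle hx).1 y (hle hy).1
  refine ⟨hxy, ?_⟩
  have h1 : σ.1.1 x y = _ := hγ ⟨x, (hle hx).2⟩ ⟨y, (hle hy).2⟩
  have h2 : σ.1.1 y x = _ := hγ ⟨y, (hle hy).2⟩ ⟨x, (hle hx).2⟩
  have h3 : (⟨x, (hle hx).2⟩ * ⟨y, (hle hy).2⟩ : N) = ⟨y, (hle hy).2⟩ * ⟨x, (hle hx).2⟩ :=
    Subtype.ext hxy
  rw [h1, h2, h3, mul_right_comm, mul_comm (γ ⟨x, _⟩), mul_right_comm]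

end

theorem theorem3 {G : Type*} [Group G] (hfg : Group.FG G) (hva : IsVirtuallyAbelian G)
    (σ : NormalizedTwoCocycle G Circle) :
    List.TFAE [
      σ.cls.IsRational,
      σ.cls.HasRootOfUnityRepresentative,
      σ.cls.IsTypeI,
      IsOfFinOrder σ.cls,
      IsSubhomogeneous (TwistedGroupCStarAlgebra σ),
      HasFiniteDimensionalRep (TwistedGroupCStarAlgebra σ)] := by
  tfae_have 1 → 3 := H2.IsTypeI.of_isRational hfg hva
  tfae_have 3 → 5 := IsSubhomogeneous.of_isTypeI hfg hva
  tfae_have 5 → 6 := HasFiniteDimensionalRep.of_isSubhomogeneous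
  tfae_have 6 → 4 := isOfFinOrder_cls_of_hasFiniteDimensionalRep
  tfae_have 4 → 2 := H2.HasRootOfUnityRepresentative.of_isOfFinOrder
  tfae_have 2 → 1 := H2.IsRational.of_hasRootOfUnityRepresentative
  tfae_finish
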